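/- **Theorem 1.** Let $L$ be a complex simple Lie algebra of type $F_4$, $H$ a Cartan subalgebra, $\Phi$ the set of roots, and $a,b,c,d$ simple roots labelled along the Dynkin diagram so that $a,b$ are long and $c,d$ are short (that is, $2(b,c)/(c,c)=-2$, $2(c,b)/(b,b)=-1$, the other neighbouring pairs $\{a,b\}$, $\{c,d\}$ have Cartan integers $-1$, and non-neighbouring simple roots are orthogonal). Write $\alpha\beta\gamma\delta$ for $\alpha a+\beta b+\gamma c+\delta d$ and order these vectors by $x\prec y$ if and only if the first nonzero coefficient of $y-x$ is positive. For every root $r$ choose a root vector $e_r\in L_r$ such that $[e_r,e_{-r}]$ is the coroot $h_r$, and define the structure constants by $[e_r,e_s]=N_{r,s}e_{r+s}$ if $r,s,r+s\in\Phi$, and $N_{r,s}=0$ if $r,s\in\Phi$, $r+s\notin\Phi$. A pair of roots $(r,s)$ is called special if $0\prec r\prec s$ and $r+s\in\Phi$; it is called extraspecial if moreover $r\preccurlyeq r'$ for every special pair $(r',s')$ with $r'+s'=r+s$. Let $\varepsilon_0,\dots,\varepsilon_9,\delta_1,\dots,\delta_6,\gamma_1,\gamma_2,\gamma_3,\alpha_1\in\{1,-1\}$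 and write $\varepsilon_{ij\dots k}=\varepsilon_i\varepsilon_j\cdots\varepsilon_k$, and similarly for $\delta,\gamma$. Suppose that the structure constants of the extraspecial pairs are those of the following list, in which each item "$s: v$" in the line of $r$ means $N_{r,s}=v$: - $r=0001$: $0010:\,\varepsilon_{1}$; $0110:\,\varepsilon_{2}$; $0120:\,\varepsilon_{3}$; $0121:\,2\varepsilon_{4}$; $1110:\,\varepsilon_{5}$; $1120:\,\varepsilon_{6}$; $1121:\,2\varepsilon_{7}$; $1220:\,\varepsilon_{8}$; $1221:\,2\varepsilon_{9}$; $1231:\,\varepsilon_{0}$. - $r=0010$: $0100:\,\delta_{1}$; $0110:\,2\delta_{2}$; $1100:\,\delta_{3}$; $1110:\,2\delta_{4}$; $1221:\,\delta_{5}$; $1232:\,2\delta_{6}$. - $r=0100$: $1000:\,\gamma_{1}$; $1120:\,\gamma_{2}$; $1242:\,\gamma_{3}$. - $r=1000$: $1342:\,\alpha_{1}$. Then the pairs in this list are exactly the extraspecial pairs, and the values of all nonzero structure constants $N_{r,s}$ and $N_{r,-s}$ with $r,s\in\Phi$, $0\prec r\prec s$, are as follows. (1) Besides the values above, the nonzero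 $N_{r,s}$ with $0\prec r\prec s$ are exactly the following ("$s:v$" means $N_{r,s}=v$): - $r=0010$: $0111:\,\varepsilon_{23}\delta_{2}$; $1111:\,\varepsilon_{56}\delta_{4}$; $1222:\,\varepsilon_{90}\delta_{5}$. - $r=0011$: $0100:\,\varepsilon_{12}\delta_{1}$; $0110:\,\varepsilon_{13}\delta_{2}$; $0111:\,2\varepsilon_{1234}\delta_{2}$; $1100:\,\varepsilon_{15}\delta_{3}$; $1110:\,\varepsilon_{16}\delta_{4}$; $1111:\,2\varepsilon_{1567}\delta_{4}$; $1220:\,-\varepsilon_{18}\delta_{5}$; $1221:\,-\varepsilon_{10}\delta_{5}$; $1231:\,-2\varepsilon_{10}\delta_{6}$. - $r=0100$: $1121:\,\varepsilon_{68}\gamma_{2}$; $1122:\,\varepsilon_{6789}\gamma_{2}$. - $r=0110$: $1000:\,\delta_{13}\gamma_{1}$; $1110:\,-2\delta_{14}\gamma_{2}$; $1111:\,-\varepsilon_{58}\delta_{14}\gamma_{2}$; $1121:\,\varepsilon_{68}\delta_{15}\gamma_{2}$; $1122:\,\varepsilon_{6780}\delta_{15}\gamma_{2}$; $1232:\,-2\delta_{16}\gamma_{3}$.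 - $r=0111$: $1000:\,\varepsilon_{25}\delta_{13}\gamma_{1}$; $1110:\,-\varepsilon_{28}\delta_{14}\gamma_{2}$; $1111:\,-2\varepsilon_{2589}\delta_{14}\gamma_{2}$; $1120:\,-\varepsilon_{28}\delta_{15}\gamma_{2}$; $1121:\,-\varepsilon_{2680}\delta_{15}\gamma_{2}$; $1231:\,2\varepsilon_{20}\delta_{16}\gamma_{3}$. - $r=0120$: $1000:\,\delta_{1234}\gamma_{1}$; $1100:\,\delta_{1234}\gamma_{2}$; $1111:\,-\varepsilon_{58}\delta_{1245}\gamma_{2}$; $1122:\,\varepsilon_{6780}\delta_{1256}\gamma_{2}$; $1222:\,\varepsilon_{90}\delta_{1256}\gamma_{3}$. - $r=0121$: $1000:\,\varepsilon_{36}\delta_{1234}\gamma_{1}$; $1100:\,\varepsilon_{38}\delta_{1234}\gamma_{2}$; $1110:\,\varepsilon_{38}\delta_{1245}\gamma_{2}$; $1111:\,-\varepsilon_{3580}\delta_{1245}\gamma_{2}$; $1121:\,-2\varepsilon_{3680}\delta_{1256}\gamma_{2}$; $1221:\,-2\varepsilon_{30}\delta_{1256}\gamma_{3}$. - $r=0122$: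 $1000:\,\varepsilon_{3467}\delta_{1234}\gamma_{1}$; $1100:\,\varepsilon_{3489}\delta_{1234}\gamma_{2}$; $1110:\,\varepsilon_{3480}\delta_{1245}\gamma_{2}$; $1120:\,\varepsilon_{3480}\delta_{1256}\gamma_{2}$; $1220:\,\varepsilon_{3480}\delta_{1256}\gamma_{3}$. - $r=1100$: $1242:\,-\gamma_{13}\alpha_{1}$. - $r=1110$: $1232:\,2\delta_{36}\gamma_{13}\alpha_{1}$. - $r=1111$: $1231:\,-2\varepsilon_{50}\delta_{36}\gamma_{13}\alpha_{1}$. - $r=1120$: $1222:\,-\varepsilon_{90}\delta_{3456}\gamma_{13}\alpha_{1}$. - $r=1121$: $1221:\,2\varepsilon_{60}\delta_{3456}\gamma_{13}\alpha_{1}$. - $r=1122$: $1220:\,-\varepsilon_{6780}\delta_{3456}\gamma_{13}\alpha_{1}$. (2) The nonzero $N_{r,-s}$ with $0\prec r\prec s$ are exactly the following ("$s:v$" means $N_{r,-s}=v$): - $r=0001$: $0011:\,-\varepsilon_{1}$; $0111:\,-\varepsilon_{2}$; $0121:\,-2\varepsilon_{3}$; $0122:\,-\varepsilon_{4}$; $1111:\,-\varepsilon_{5}$;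 $1121:\,-2\varepsilon_{6}$; $1122:\,-\varepsilon_{7}$; $1221:\,-2\varepsilon_{8}$; $1222:\,-\varepsilon_{9}$; $1232:\,-\varepsilon_{0}$. - $r=0010$: $0011:\,\varepsilon_{1}$; $0110:\,-2\delta_{1}$; $0120:\,-\delta_{2}$; $0121:\,-\varepsilon_{23}\delta_{2}$; $1110:\,-2\delta_{3}$; $1120:\,-\delta_{4}$; $1121:\,-\varepsilon_{56}\delta_{4}$; $1231:\,-\delta_{5}$; $1232:\,-2\varepsilon_{90}\delta_{5}$; $1242:\,-\delta_{6}$. - $r=0011$: $0111:\,-2\varepsilon_{12}\delta_{1}$; $0121:\,-\varepsilon_{13}\delta_{2}$; $0122:\,-\varepsilon_{1234}\delta_{2}$; $1111:\,-2\varepsilon_{15}\delta_{3}$; $1121:\,-\varepsilon_{16}\delta_{4}$; $1122:\,-\varepsilon_{1567}\delta_{4}$; $1231:\,2\varepsilon_{18}\delta_{5}$; $1232:\,\varepsilon_{10}\delta_{5}$; $1242:\,\varepsilon_{10}\delta_{6}$. - $r=0100$: $0110:\,\delta_{1}$; $0111:\,\varepsilon_{12}\delta_{1}$; $1100:\,-\gamma_{1}$;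 $1220:\,-\gamma_{2}$; $1221:\,-\varepsilon_{68}\gamma_{2}$; $1222:\,-\varepsilon_{6789}\gamma_{2}$; $1342:\,-\gamma_{3}$. - $r=0110$: $0111:\,\varepsilon_{2}$; $0120:\,\delta_{2}$; $0121:\,\varepsilon_{13}\delta_{2}$; $1110:\,-2\delta_{13}\gamma_{1}$; $1220:\,\delta_{14}\gamma_{2}$; $1221:\,\varepsilon_{58}\delta_{14}\gamma_{2}$; $1231:\,-\varepsilon_{68}\delta_{15}\gamma_{2}$; $1232:\,-2\varepsilon_{6780}\delta_{15}\gamma_{2}$; $1342:\,\delta_{16}\gamma_{3}$. - $r=0111$: $0121:\,\varepsilon_{23}\delta_{2}$; $0122:\,\varepsilon_{1234}\delta_{2}$; $1111:\,-2\varepsilon_{25}\delta_{13}\gamma_{1}$; $1221:\,\varepsilon_{28}\delta_{14}\gamma_{2}$; $1222:\,\varepsilon_{2589}\delta_{14}\gamma_{2}$; $1231:\,2\varepsilon_{28}\delta_{15}\gamma_{2}$; $1232:\,\varepsilon_{2680}\delta_{15}\gamma_{2}$; $1342:\,-\varepsilon_{20}\delta_{16}\gamma_{3}$. - $r=0120$: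 $0121:\,\varepsilon_{3}$; $1120:\,-\delta_{1234}\gamma_{1}$; $1220:\,-\delta_{1234}\gamma_{2}$; $1231:\,\varepsilon_{58}\delta_{1245}\gamma_{2}$; $1242:\,-\varepsilon_{6780}\delta_{1256}\gamma_{2}$; $1342:\,-\varepsilon_{90}\delta_{1256}\gamma_{3}$. - $r=0121$: $0122:\,\varepsilon_{4}$; $1121:\,-2\varepsilon_{36}\delta_{1234}\gamma_{1}$; $1221:\,-2\varepsilon_{38}\delta_{1234}\gamma_{2}$; $1231:\,-\varepsilon_{38}\delta_{1245}\gamma_{2}$; $1232:\,\varepsilon_{3580}\delta_{1245}\gamma_{2}$; $1242:\,\varepsilon_{3680}\delta_{1256}\gamma_{2}$; $1342:\,\varepsilon_{30}\delta_{1256}\gamma_{3}$. - $r=0122$: $1122:\,-\varepsilon_{3467}\delta_{1234}\gamma_{1}$; $1222:\,-\varepsilon_{3489}\delta_{1234}\gamma_{2}$; $1232:\,-\varepsilon_{3480}\delta_{1245}\gamma_{2}$; $1242:\,-\varepsilon_{3480}\delta_{1256}\gamma_{2}$; $1342:\,-\varepsilon_{3480}\delta_{1256}\gamma_{3}$. -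 $r=1000$: $1100:\,\gamma_{1}$; $1110:\,\delta_{13}\gamma_{1}$; $1111:\,\varepsilon_{25}\delta_{13}\gamma_{1}$; $1120:\,\delta_{1234}\gamma_{1}$; $1121:\,\varepsilon_{36}\delta_{1234}\gamma_{1}$; $1122:\,\varepsilon_{3467}\delta_{1234}\gamma_{1}$; $2342:\,-\alpha_{1}$. - $r=1100$: $1110:\,\delta_{3}$; $1111:\,\varepsilon_{15}\delta_{3}$; $1220:\,\delta_{1234}\gamma_{2}$; $1221:\,\varepsilon_{38}\delta_{1234}\gamma_{2}$; $1222:\,\varepsilon_{3489}\delta_{1234}\gamma_{2}$; $2342:\,\gamma_{13}\alpha_{1}$. - $r=1110$: $1111:\,\varepsilon_{5}$; $1120:\,\delta_{4}$; $1121:\,\varepsilon_{16}\delta_{4}$; $1220:\,-\delta_{14}\gamma_{2}$; $1221:\,-\varepsilon_{28}\delta_{14}\gamma_{2}$; $1231:\,\varepsilon_{38}\delta_{1245}\gamma_{2}$; $1232:\,2\varepsilon_{3480}\delta_{1245}\gamma_{2}$; $2342:\,-\delta_{36}\gamma_{13}\alpha_{1}$. - $r=1111$: $1121:\,\varepsilon_{56}\delta_{4}$;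 $1122:\,\varepsilon_{1567}\delta_{4}$; $1221:\,-\varepsilon_{58}\delta_{14}\gamma_{2}$; $1222:\,-\varepsilon_{2589}\delta_{14}\gamma_{2}$; $1231:\,-2\varepsilon_{58}\delta_{1245}\gamma_{2}$; $1232:\,-\varepsilon_{3580}\delta_{1245}\gamma_{2}$; $2342:\,\varepsilon_{50}\delta_{36}\gamma_{13}\alpha_{1}$. - $r=1120$: $1121:\,\varepsilon_{6}$; $1220:\,\gamma_{2}$; $1231:\,-\varepsilon_{28}\delta_{15}\gamma_{2}$; $1242:\,\varepsilon_{3480}\delta_{1256}\gamma_{2}$; $2342:\,\varepsilon_{90}\delta_{3456}\gamma_{13}\alpha_{1}$. - $r=1121$: $1122:\,\varepsilon_{7}$; $1221:\,2\varepsilon_{68}\gamma_{2}$; $1231:\,\varepsilon_{68}\delta_{15}\gamma_{2}$; $1232:\,-\varepsilon_{2680}\delta_{15}\gamma_{2}$; $1242:\,-\varepsilon_{3680}\delta_{1256}\gamma_{2}$; $2342:\,-\varepsilon_{60}\delta_{3456}\gamma_{13}\alpha_{1}$. - $r=1122$: $1222:\,\varepsilon_{6789}\gamma_{2}$; $1232:\,\varepsilon_{6780}\delta_{15}\gamma_{2}$;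 $1242:\,\varepsilon_{6780}\delta_{1256}\gamma_{2}$; $2342:\,\varepsilon_{6780}\delta_{3456}\gamma_{13}\alpha_{1}$. - $r=1220$: $1221:\,\varepsilon_{8}$; $1231:\,-\varepsilon_{18}\delta_{5}$; $1342:\,\varepsilon_{3480}\delta_{1256}\gamma_{3}$; $2342:\,-\varepsilon_{6780}\delta_{3456}\gamma_{13}\alpha_{1}$. - $r=1221$: $1222:\,\varepsilon_{9}$; $1231:\,\delta_{5}$; $1232:\,-\varepsilon_{10}\delta_{5}$; $1342:\,-\varepsilon_{30}\delta_{1256}\gamma_{3}$; $2342:\,\varepsilon_{60}\delta_{3456}\gamma_{13}\alpha_{1}$. - $r=1222$: $1232:\,\varepsilon_{90}\delta_{5}$; $1342:\,\varepsilon_{90}\delta_{1256}\gamma_{3}$; $2342:\,-\varepsilon_{90}\delta_{3456}\gamma_{13}\alpha_{1}$. - $r=1231$: $1232:\,\varepsilon_{0}$; $1242:\,-\varepsilon_{10}\delta_{6}$; $1342:\,\varepsilon_{20}\delta_{16}\gamma_{3}$; $2342:\,-\varepsilon_{50}\delta_{36}\gamma_{13}\alpha_{1}$. - $r=1232$: $1242:\,\delta_{6}$;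 $1342:\,-\delta_{16}\gamma_{3}$; $2342:\,\delta_{36}\gamma_{13}\alpha_{1}$. - $r=1242$: $1342:\,\gamma_{3}$; $2342:\,-\gamma_{13}\alpha_{1}$. - $r=1342$: $2342:\,\alpha_{1}$. -/

import Mathlib

open LieAlgebra LieAlgebra.IsKilling

namespace F4Table

section Roots

variable {L : Type*} [LieRing L] [LieAlgebra ℂ L] [FiniteDimensional ℂ L] [IsKilling ℂ L]
variable (H : LieSubalgebra ℂ L) [H.IsCartanSubalgebra]

/-- The set of roots of `L` with respect to the Cartan subalgebra `H`, as functionals on `H`. -/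
def roots : Set (Module.Dual ℂ H) := Set.range (rootSystem H).root

/-- A choice of root vectors `e r ∈ L_r`, one for every root `r`, such that `[e r, e (-r)]` is the
coroot `h_r`. (The values of `e` away from the roots are irrelevant.) -/
structure IsRootVectors (e : Module.Dual ℂ H → L) : Prop where
  mem_rootSpace : ∀ r : H.root, e ((rootSystem H).root r) ∈ rootSpace H r.1
  lie_neg : ∀ r : H.root,
    ⁅e ((rootSystem H).root r), e (-(rootSystem H).root r)⁆ = ((rootSystem H).coroot r : L)

/-- `N r s` are the structure constants of the root vectors `e`: for roots `r`, `s` one has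
`[e r, e s] = N r s • e (r + s)` if `r + s` is a root, and `N r s = 0` if it is not. -/
structure IsStructureConstants (e : Module.Dual ℂ H → L)
    (N : Module.Dual ℂ H → Module.Dual ℂ H → ℂ) : Prop where
  lie_eq : ∀ r ∈ roots H, ∀ s ∈ roots H, r + s ∈ roots H → ⁅e r, e s⁆ = N r s • e (r + s)
  eq_zero : ∀ r ∈ roots H, ∀ s ∈ roots H, r + s ∉ roots H → N r s = 0

end Roots

/-- A quadruple `![x₀, x₁, x₂, x₃]` stands for the element `x₀ a + x₁ b + x₂ c + x₃ d` of the root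
lattice, where `a, b, c, d` are the simple roots. -/
abbrev Quad := Fin 4 → ℤ

/-- The order `≺`: the first nonzero coefficient of `y - x` is positive. -/
def Prec (x y : Quad) : Prop := ∃ i, (∀ j < i, y j - x j = 0) ∧ 0 < y i - x i

section Quadruples

variable {L : Type*} [LieRing L] [LieAlgebra ℂ L] [FiniteDimensional ℂ L] [IsKilling ℂ L]
variable {H : LieSubalgebra ℂ L} [H.IsCartanSubalgebra]
variable {B : (rootSystem H).Base} (p : Fin 4 ≃ B.support)

/-- `a, b, c, d = p 0, p 1, p 2, p 3` is a labelling of a system of simple roots by the nodes of the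
Dynkin diagram of type `F₄`: `a`, `b` are long, `c`, `d` are short. The `(i, j)` entry of the
Cartan matrix is `2 (p i, p j) / (p j, p j)`. -/
def IsTypeF4 : Prop := ∀ i j, B.cartanMatrix (p i) (p j) = CartanMatrix.F₄ i j

/-- The functional `x₀ a + x₁ b + x₂ c + x₃ d` on `H`. -/
noncomputable def toDual (x : Quad) : Module.Dual ℂ H := ∑ i, x i • (rootSystem H).root (p i)

/-- The quadruple `x` represents a root. -/
def IsRoot (x : Quad) : Prop := toDual p x ∈ roots H

/-- `(x, y)` is a special pair of roots: `0 ≺ x ≺ y` and `x + y` is a root. -/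
def IsSpecial (x y : Quad) : Prop :=
  IsRoot p x ∧ IsRoot p y ∧ IsRoot p (x + y) ∧ Prec 0 x ∧ Prec x y

/-- `(x, y)` is an extraspecial pair of roots: it is special, and `x ≼ x'` for every special pair
`(x', y')` with the same sum. -/
def IsExtraspecial (x y : Quad) : Prop :=
  IsSpecial p x y ∧ ∀ x' y', IsSpecial p x' y' → x' + y' = x + y → x = x' ∨ Prec x x'

end Quadruples

/-- `f_{ij...k} = f_i f_j ... f_k` for the list `[i, j, ..., k]` of indices. -/
def sgn (f : ℕ → ℤˣ) (l : List ℕ) : ℤ := ((l.map f).prod : ℤˣ)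

/-- The rows `(r, s, c)` of a table that share the first entry `r`. -/
def row (r : Quad) (l : List (Quad × ℤ)) : List (Quad × Quad × ℤ) := l.map fun t => (r, t.1, t.2)

/-- The values assigned to the structure constants `N_{r,s}` of the extraspecial pairs:
a triple `(r, s, c)` stands for `N_{r,s} = c`. -/
def extraspecialTable (ε δ γ α : ℕ → ℤˣ) : List (Quad × Quad × ℤ) :=
  row ![0, 0, 0, 1] [
    (![0, 0, 1, 0], sgn ε [1]),
    (![0, 1, 1, 0], sgn ε [2]),
    (![0, 1, 2, 0], sgn ε [3]),
    (![0, 1, 2, 1], 2 * sgn ε [4]),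
    (![1, 1, 1, 0], sgn ε [5]),
    (![1, 1, 2, 0], sgn ε [6]),
    (![1, 1, 2, 1], 2 * sgn ε [7]),
    (![1, 2, 2, 0], sgn ε [8]),
    (![1, 2, 2, 1], 2 * sgn ε [9]),
    (![1, 2, 3, 1], sgn ε [0])] ++
  row ![0, 0, 1, 0] [
    (![0, 1, 0, 0], sgn δ [1]),
    (![0, 1, 1, 0], 2 * sgn δ [2]),
    (![1, 1, 0, 0], sgn δ [3]),
    (![1, 1, 1, 0], 2 * sgn δ [4]),
    (![1, 2, 2, 1], sgn δ [5]),
    (![1, 2, 3, 2], 2 * sgn δ [6])] ++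
  row ![0, 1, 0, 0] [
    (![1, 0, 0, 0], sgn γ [1]),
    (![1, 1, 2, 0], sgn γ [2]),
    (![1, 2, 4, 2], sgn γ [3])] ++
  row ![1, 0, 0, 0] [
    (![1, 3, 4, 2], sgn α [1])]

/-- The values of `N_{r,s}`, `0 ≺ r ≺ s`, for the pairs that are not extraspecial:
a triple `(r, s, c)` stands for `N_{r,s} = c`. -/
def positiveTable (ε δ γ α : ℕ → ℤˣ) : List (Quad × Quad × ℤ) :=
  row ![0, 0, 1, 0] [
    (![0, 1, 1, 1], sgn ε [2, 3] * sgn δ [2]),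
    (![1, 1, 1, 1], sgn ε [5, 6] * sgn δ [4]),
    (![1, 2, 2, 2], sgn ε [9, 0] * sgn δ [5])] ++
  row ![0, 0, 1, 1] [
    (![0, 1, 0, 0], sgn ε [1, 2] * sgn δ [1]),
    (![0, 1, 1, 0], sgn ε [1, 3] * sgn δ [2]),
    (![0, 1, 1, 1], 2 * sgn ε [1, 2, 3, 4] * sgn δ [2]),
    (![1, 1, 0, 0], sgn ε [1, 5] * sgn δ [3]),
    (![1, 1, 1, 0], sgn ε [1, 6] * sgn δ [4]),
    (![1, 1, 1, 1], 2 * sgn ε [1, 5, 6, 7] * sgn δ [4]),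
    (![1, 2, 2, 0], -(sgn ε [1, 8] * sgn δ [5])),
    (![1, 2, 2, 1], -(sgn ε [1, 0] * sgn δ [5])),
    (![1, 2, 3, 1], -(2 * sgn ε [1, 0] * sgn δ [6]))] ++
  row ![0, 1, 0, 0] [
    (![1, 1, 2, 1], sgn ε [6, 8] * sgn γ [2]),
    (![1, 1, 2, 2], sgn ε [6, 7, 8, 9] * sgn γ [2])] ++
  row ![0, 1, 1, 0] [
    (![1, 0, 0, 0], sgn δ [1, 3] * sgn γ [1]),
    (![1, 1, 1, 0], -(2 * sgn δ [1, 4] * sgn γ [2])),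
    (![1, 1, 1, 1], -(sgn ε [5, 8] * sgn δ [1, 4] * sgn γ [2])),
    (![1, 1, 2, 1], sgn ε [6, 8] * sgn δ [1, 5] * sgn γ [2]),
    (![1, 1, 2, 2], sgn ε [6, 7, 8, 0] * sgn δ [1, 5] * sgn γ [2]),
    (![1, 2, 3, 2], -(2 * sgn δ [1, 6] * sgn γ [3]))] ++
  row ![0, 1, 1, 1] [
    (![1, 0, 0, 0], sgn ε [2, 5] * sgn δ [1, 3] * sgn γ [1]),
    (![1, 1, 1, 0], -(sgn ε [2, 8] * sgn δ [1, 4] * sgn γ [2])),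
    (![1, 1, 1, 1], -(2 * sgn ε [2, 5, 8, 9] * sgn δ [1, 4] * sgn γ [2])),
    (![1, 1, 2, 0], -(sgn ε [2, 8] * sgn δ [1, 5] * sgn γ [2])),
    (![1, 1, 2, 1], -(sgn ε [2, 6, 8, 0] * sgn δ [1, 5] * sgn γ [2])),
    (![1, 2, 3, 1], 2 * sgn ε [2, 0] * sgn δ [1, 6] * sgn γ [3])] ++
  row ![0, 1, 2, 0] [
    (![1, 0, 0, 0], sgn δ [1, 2, 3, 4] * sgn γ [1]),
    (![1, 1, 0, 0], sgn δ [1, 2, 3, 4] * sgn γ [2]),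
    (![1, 1, 1, 1], -(sgn ε [5, 8] * sgn δ [1, 2, 4, 5] * sgn γ [2])),
    (![1, 1, 2, 2], sgn ε [6, 7, 8, 0] * sgn δ [1, 2, 5, 6] * sgn γ [2]),
    (![1, 2, 2, 2], sgn ε [9, 0] * sgn δ [1, 2, 5, 6] * sgn γ [3])] ++
  row ![0, 1, 2, 1] [
    (![1, 0, 0, 0], sgn ε [3, 6] * sgn δ [1, 2, 3, 4] * sgn γ [1]),
    (![1, 1, 0, 0], sgn ε [3, 8] * sgn δ [1, 2, 3, 4] * sgn γ [2]),
    (![1, 1, 1, 0], sgn ε [3, 8] * sgn δ [1, 2, 4, 5] * sgn γ [2]),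
    (![1, 1, 1, 1], -(sgn ε [3, 5, 8, 0] * sgn δ [1, 2, 4, 5] * sgn γ [2])),
    (![1, 1, 2, 1], -(2 * sgn ε [3, 6, 8, 0] * sgn δ [1, 2, 5, 6] * sgn γ [2])),
    (![1, 2, 2, 1], -(2 * sgn ε [3, 0] * sgn δ [1, 2, 5, 6] * sgn γ [3]))] ++
  row ![0, 1, 2, 2] [
    (![1, 0, 0, 0], sgn ε [3, 4, 6, 7] * sgn δ [1, 2, 3, 4] * sgn γ [1]),
    (![1, 1, 0, 0], sgn ε [3, 4, 8, 9] * sgn δ [1, 2, 3, 4] * sgn γ [2]),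
    (![1, 1, 1, 0], sgn ε [3, 4, 8, 0] * sgn δ [1, 2, 4, 5] * sgn γ [2]),
    (![1, 1, 2, 0], sgn ε [3, 4, 8, 0] * sgn δ [1, 2, 5, 6] * sgn γ [2]),
    (![1, 2, 2, 0], sgn ε [3, 4, 8, 0] * sgn δ [1, 2, 5, 6] * sgn γ [3])] ++
  row ![1, 1, 0, 0] [
    (![1, 2, 4, 2], -(sgn γ [1, 3] * sgn α [1]))] ++
  row ![1, 1, 1, 0] [
    (![1, 2, 3, 2], 2 * sgn δ [3, 6] * sgn γ [1, 3] * sgn α [1])] ++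
  row ![1, 1, 1, 1] [
    (![1, 2, 3, 1], -(2 * sgn ε [5, 0] * sgn δ [3, 6] * sgn γ [1, 3] * sgn α [1]))] ++
  row ![1, 1, 2, 0] [
    (![1, 2, 2, 2], -(sgn ε [9, 0] * sgn δ [3, 4, 5, 6] * sgn γ [1, 3] * sgn α [1]))] ++
  row ![1, 1, 2, 1] [
    (![1, 2, 2, 1], 2 * sgn ε [6, 0] * sgn δ [3, 4, 5, 6] * sgn γ [1, 3] * sgn α [1])] ++
  row ![1, 1, 2, 2] [
    (![1, 2, 2, 0], -(sgn ε [6, 7, 8, 0] * sgn δ [3, 4, 5, 6] * sgn γ [1, 3] * sgn α [1]))]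

/-- The values of `N_{r,-s}`, `0 ≺ r ≺ s`: a triple `(r, s, c)` stands for `N_{r,-s} = c`. -/
def negativeTable (ε δ γ α : ℕ → ℤˣ) : List (Quad × Quad × ℤ) :=
  row ![0, 0, 0, 1] [
    (![0, 0, 1, 1], -(sgn ε [1])),
    (![0, 1, 1, 1], -(sgn ε [2])),
    (![0, 1, 2, 1], -(2 * sgn ε [3])),
    (![0, 1, 2, 2], -(sgn ε [4])),
    (![1, 1, 1, 1], -(sgn ε [5])),
    (![1, 1, 2, 1], -(2 * sgn ε [6])),
    (![1, 1, 2, 2], -(sgn ε [7])),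
    (![1, 2, 2, 1], -(2 * sgn ε [8])),
    (![1, 2, 2, 2], -(sgn ε [9])),
    (![1, 2, 3, 2], -(sgn ε [0]))] ++
  row ![0, 0, 1, 0] [
    (![0, 0, 1, 1], sgn ε [1]),
    (![0, 1, 1, 0], -(2 * sgn δ [1])),
    (![0, 1, 2, 0], -(sgn δ [2])),
    (![0, 1, 2, 1], -(sgn ε [2, 3] * sgn δ [2])),
    (![1, 1, 1, 0], -(2 * sgn δ [3])),
    (![1, 1, 2, 0], -(sgn δ [4])),
    (![1, 1, 2, 1], -(sgn ε [5, 6] * sgn δ [4])),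
    (![1, 2, 3, 1], -(sgn δ [5])),
    (![1, 2, 3, 2], -(2 * sgn ε [9, 0] * sgn δ [5])),
    (![1, 2, 4, 2], -(sgn δ [6]))] ++
  row ![0, 0, 1, 1] [
    (![0, 1, 1, 1], -(2 * sgn ε [1, 2] * sgn δ [1])),
    (![0, 1, 2, 1], -(sgn ε [1, 3] * sgn δ [2])),
    (![0, 1, 2, 2], -(sgn ε [1, 2, 3, 4] * sgn δ [2])),
    (![1, 1, 1, 1], -(2 * sgn ε [1, 5] * sgn δ [3])),
    (![1, 1, 2, 1], -(sgn ε [1, 6] * sgn δ [4])),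
    (![1, 1, 2, 2], -(sgn ε [1, 5, 6, 7] * sgn δ [4])),
    (![1, 2, 3, 1], 2 * sgn ε [1, 8] * sgn δ [5]),
    (![1, 2, 3, 2], sgn ε [1, 0] * sgn δ [5]),
    (![1, 2, 4, 2], sgn ε [1, 0] * sgn δ [6])] ++
  row ![0, 1, 0, 0] [
    (![0, 1, 1, 0], sgn δ [1]),
    (![0, 1, 1, 1], sgn ε [1, 2] * sgn δ [1]),
    (![1, 1, 0, 0], -(sgn γ [1])),
    (![1, 2, 2, 0], -(sgn γ [2])),
    (![1, 2, 2, 1], -(sgn ε [6, 8] * sgn γ [2])),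
    (![1, 2, 2, 2], -(sgn ε [6, 7, 8, 9] * sgn γ [2])),
    (![1, 3, 4, 2], -(sgn γ [3]))] ++
  row ![0, 1, 1, 0] [
    (![0, 1, 1, 1], sgn ε [2]),
    (![0, 1, 2, 0], sgn δ [2]),
    (![0, 1, 2, 1], sgn ε [1, 3] * sgn δ [2]),
    (![1, 1, 1, 0], -(2 * sgn δ [1, 3] * sgn γ [1])),
    (![1, 2, 2, 0], sgn δ [1, 4] * sgn γ [2]),
    (![1, 2, 2, 1], sgn ε [5, 8] * sgn δ [1, 4] * sgn γ [2]),
    (![1, 2, 3, 1], -(sgn ε [6, 8] * sgn δ [1, 5] * sgn γ [2])),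
    (![1, 2, 3, 2], -(2 * sgn ε [6, 7, 8, 0] * sgn δ [1, 5] * sgn γ [2])),
    (![1, 3, 4, 2], sgn δ [1, 6] * sgn γ [3])] ++
  row ![0, 1, 1, 1] [
    (![0, 1, 2, 1], sgn ε [2, 3] * sgn δ [2]),
    (![0, 1, 2, 2], sgn ε [1, 2, 3, 4] * sgn δ [2]),
    (![1, 1, 1, 1], -(2 * sgn ε [2, 5] * sgn δ [1, 3] * sgn γ [1])),
    (![1, 2, 2, 1], sgn ε [2, 8] * sgn δ [1, 4] * sgn γ [2]),
    (![1, 2, 2, 2], sgn ε [2, 5, 8, 9] * sgn δ [1, 4] * sgn γ [2]),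
    (![1, 2, 3, 1], 2 * sgn ε [2, 8] * sgn δ [1, 5] * sgn γ [2]),
    (![1, 2, 3, 2], sgn ε [2, 6, 8, 0] * sgn δ [1, 5] * sgn γ [2]),
    (![1, 3, 4, 2], -(sgn ε [2, 0] * sgn δ [1, 6] * sgn γ [3]))] ++
  row ![0, 1, 2, 0] [
    (![0, 1, 2, 1], sgn ε [3]),
    (![1, 1, 2, 0], -(sgn δ [1, 2, 3, 4] * sgn γ [1])),
    (![1, 2, 2, 0], -(sgn δ [1, 2, 3, 4] * sgn γ [2])),
    (![1, 2, 3, 1], sgn ε [5, 8] * sgn δ [1, 2, 4, 5] * sgn γ [2]),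
    (![1, 2, 4, 2], -(sgn ε [6, 7, 8, 0] * sgn δ [1, 2, 5, 6] * sgn γ [2])),
    (![1, 3, 4, 2], -(sgn ε [9, 0] * sgn δ [1, 2, 5, 6] * sgn γ [3]))] ++
  row ![0, 1, 2, 1] [
    (![0, 1, 2, 2], sgn ε [4]),
    (![1, 1, 2, 1], -(2 * sgn ε [3, 6] * sgn δ [1, 2, 3, 4] * sgn γ [1])),
    (![1, 2, 2, 1], -(2 * sgn ε [3, 8] * sgn δ [1, 2, 3, 4] * sgn γ [2])),
    (![1, 2, 3, 1], -(sgn ε [3, 8] * sgn δ [1, 2, 4, 5] * sgn γ [2])),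
    (![1, 2, 3, 2], sgn ε [3, 5, 8, 0] * sgn δ [1, 2, 4, 5] * sgn γ [2]),
    (![1, 2, 4, 2], sgn ε [3, 6, 8, 0] * sgn δ [1, 2, 5, 6] * sgn γ [2]),
    (![1, 3, 4, 2], sgn ε [3, 0] * sgn δ [1, 2, 5, 6] * sgn γ [3])] ++
  row ![0, 1, 2, 2] [
    (![1, 1, 2, 2], -(sgn ε [3, 4, 6, 7] * sgn δ [1, 2, 3, 4] * sgn γ [1])),
    (![1, 2, 2, 2], -(sgn ε [3, 4, 8, 9] * sgn δ [1, 2, 3, 4] * sgn γ [2])),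
    (![1, 2, 3, 2], -(sgn ε [3, 4, 8, 0] * sgn δ [1, 2, 4, 5] * sgn γ [2])),
    (![1, 2, 4, 2], -(sgn ε [3, 4, 8, 0] * sgn δ [1, 2, 5, 6] * sgn γ [2])),
    (![1, 3, 4, 2], -(sgn ε [3, 4, 8, 0] * sgn δ [1, 2, 5, 6] * sgn γ [3]))] ++
  row ![1, 0, 0, 0] [
    (![1, 1, 0, 0], sgn γ [1]),
    (![1, 1, 1, 0], sgn δ [1, 3] * sgn γ [1]),
    (![1, 1, 1, 1], sgn ε [2, 5] * sgn δ [1, 3] * sgn γ [1]),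
    (![1, 1, 2, 0], sgn δ [1, 2, 3, 4] * sgn γ [1]),
    (![1, 1, 2, 1], sgn ε [3, 6] * sgn δ [1, 2, 3, 4] * sgn γ [1]),
    (![1, 1, 2, 2], sgn ε [3, 4, 6, 7] * sgn δ [1, 2, 3, 4] * sgn γ [1]),
    (![2, 3, 4, 2], -(sgn α [1]))] ++
  row ![1, 1, 0, 0] [
    (![1, 1, 1, 0], sgn δ [3]),
    (![1, 1, 1, 1], sgn ε [1, 5] * sgn δ [3]),
    (![1, 2, 2, 0], sgn δ [1, 2, 3, 4] * sgn γ [2]),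
    (![1, 2, 2, 1], sgn ε [3, 8] * sgn δ [1, 2, 3, 4] * sgn γ [2]),
    (![1, 2, 2, 2], sgn ε [3, 4, 8, 9] * sgn δ [1, 2, 3, 4] * sgn γ [2]),
    (![2, 3, 4, 2], sgn γ [1, 3] * sgn α [1])] ++
  row ![1, 1, 1, 0] [
    (![1, 1, 1, 1], sgn ε [5]),
    (![1, 1, 2, 0], sgn δ [4]),
    (![1, 1, 2, 1], sgn ε [1, 6] * sgn δ [4]),
    (![1, 2, 2, 0], -(sgn δ [1, 4] * sgn γ [2])),
    (![1, 2, 2, 1], -(sgn ε [2, 8] * sgn δ [1, 4] * sgn γ [2])),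
    (![1, 2, 3, 1], sgn ε [3, 8] * sgn δ [1, 2, 4, 5] * sgn γ [2]),
    (![1, 2, 3, 2], 2 * sgn ε [3, 4, 8, 0] * sgn δ [1, 2, 4, 5] * sgn γ [2]),
    (![2, 3, 4, 2], -(sgn δ [3, 6] * sgn γ [1, 3] * sgn α [1]))] ++
  row ![1, 1, 1, 1] [
    (![1, 1, 2, 1], sgn ε [5, 6] * sgn δ [4]),
    (![1, 1, 2, 2], sgn ε [1, 5, 6, 7] * sgn δ [4]),
    (![1, 2, 2, 1], -(sgn ε [5, 8] * sgn δ [1, 4] * sgn γ [2])),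
    (![1, 2, 2, 2], -(sgn ε [2, 5, 8, 9] * sgn δ [1, 4] * sgn γ [2])),
    (![1, 2, 3, 1], -(2 * sgn ε [5, 8] * sgn δ [1, 2, 4, 5] * sgn γ [2])),
    (![1, 2, 3, 2], -(sgn ε [3, 5, 8, 0] * sgn δ [1, 2, 4, 5] * sgn γ [2])),
    (![2, 3, 4, 2], sgn ε [5, 0] * sgn δ [3, 6] * sgn γ [1, 3] * sgn α [1])] ++
  row ![1, 1, 2, 0] [
    (![1, 1, 2, 1], sgn ε [6]),
    (![1, 2, 2, 0], sgn γ [2]),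
    (![1, 2, 3, 1], -(sgn ε [2, 8] * sgn δ [1, 5] * sgn γ [2])),
    (![1, 2, 4, 2], sgn ε [3, 4, 8, 0] * sgn δ [1, 2, 5, 6] * sgn γ [2]),
    (![2, 3, 4, 2], sgn ε [9, 0] * sgn δ [3, 4, 5, 6] * sgn γ [1, 3] * sgn α [1])] ++
  row ![1, 1, 2, 1] [
    (![1, 1, 2, 2], sgn ε [7]),
    (![1, 2, 2, 1], 2 * sgn ε [6, 8] * sgn γ [2]),
    (![1, 2, 3, 1], sgn ε [6, 8] * sgn δ [1, 5] * sgn γ [2]),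
    (![1, 2, 3, 2], -(sgn ε [2, 6, 8, 0] * sgn δ [1, 5] * sgn γ [2])),
    (![1, 2, 4, 2], -(sgn ε [3, 6, 8, 0] * sgn δ [1, 2, 5, 6] * sgn γ [2])),
    (![2, 3, 4, 2], -(sgn ε [6, 0] * sgn δ [3, 4, 5, 6] * sgn γ [1, 3] * sgn α [1]))] ++
  row ![1, 1, 2, 2] [
    (![1, 2, 2, 2], sgn ε [6, 7, 8, 9] * sgn γ [2]),
    (![1, 2, 3, 2], sgn ε [6, 7, 8, 0] * sgn δ [1, 5] * sgn γ [2]),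
    (![1, 2, 4, 2], sgn ε [6, 7, 8, 0] * sgn δ [1, 2, 5, 6] * sgn γ [2]),
    (![2, 3, 4, 2], sgn ε [6, 7, 8, 0] * sgn δ [3, 4, 5, 6] * sgn γ [1, 3] * sgn α [1])] ++
  row ![1, 2, 2, 0] [
    (![1, 2, 2, 1], sgn ε [8]),
    (![1, 2, 3, 1], -(sgn ε [1, 8] * sgn δ [5])),
    (![1, 3, 4, 2], sgn ε [3, 4, 8, 0] * sgn δ [1, 2, 5, 6] * sgn γ [3]),
    (![2, 3, 4, 2], -(sgn ε [6, 7, 8, 0] * sgn δ [3, 4, 5, 6] * sgn γ [1, 3] * sgn α [1]))] ++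
  row ![1, 2, 2, 1] [
    (![1, 2, 2, 2], sgn ε [9]),
    (![1, 2, 3, 1], sgn δ [5]),
    (![1, 2, 3, 2], -(sgn ε [1, 0] * sgn δ [5])),
    (![1, 3, 4, 2], -(sgn ε [3, 0] * sgn δ [1, 2, 5, 6] * sgn γ [3])),
    (![2, 3, 4, 2], sgn ε [6, 0] * sgn δ [3, 4, 5, 6] * sgn γ [1, 3] * sgn α [1])] ++
  row ![1, 2, 2, 2] [
    (![1, 2, 3, 2], sgn ε [9, 0] * sgn δ [5]),
    (![1, 3, 4, 2], sgn ε [9, 0] * sgn δ [1, 2, 5, 6] * sgn γ [3]),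
    (![2, 3, 4, 2], -(sgn ε [9, 0] * sgn δ [3, 4, 5, 6] * sgn γ [1, 3] * sgn α [1]))] ++
  row ![1, 2, 3, 1] [
    (![1, 2, 3, 2], sgn ε [0]),
    (![1, 2, 4, 2], -(sgn ε [1, 0] * sgn δ [6])),
    (![1, 3, 4, 2], sgn ε [2, 0] * sgn δ [1, 6] * sgn γ [3]),
    (![2, 3, 4, 2], -(sgn ε [5, 0] * sgn δ [3, 6] * sgn γ [1, 3] * sgn α [1]))] ++
  row ![1, 2, 3, 2] [
    (![1, 2, 4, 2], sgn δ [6]),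
    (![1, 3, 4, 2], -(sgn δ [1, 6] * sgn γ [3])),
    (![2, 3, 4, 2], sgn δ [3, 6] * sgn γ [1, 3] * sgn α [1])] ++
  row ![1, 2, 4, 2] [
    (![1, 3, 4, 2], sgn γ [3]),
    (![2, 3, 4, 2], -(sgn γ [1, 3] * sgn α [1]))] ++
  row ![1, 3, 4, 2] [
    (![2, 3, 4, 2], sgn α [1])]

end F4Table

open LieAlgebra LieAlgebra.IsKilling

namespace F4Table

/-! The Lie algebra enters through two inputs only: which quadruples are roots, with which Cartan
integers, and a few identities between structure constants. Everything else is arithmetic on 48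
quadruples, done by evaluation.

Roots: simple reflections and negation generate all roots from the simple ones (`exists_quad`), and
conversely every listed positive root descends to a simple root through simple reflections that
lower the height (`isRoot_iff`). The Cartan integers come from the inner product with (a,a) = (b,b)
= 4 and (c,c) = (d,d) = 2.

Identities (`Relations`): antisymmetry, vanishing when the sum is not a root, and three cases of
Jacobi's identity. The case e_{-x}, e_x, e_y yields products N_{x,y} N_{-x,x+y}; roots no two of
which are opposite give a quadratic relation; roots with sum zero give a linear relation between
three coroots.

Signs: replacing e_x by η(x) e_x with η(x) = η(-x) = ±1 multiplies N_{x,y} by η(x)η(y)η(x+y) and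
preserves the relations (`Relations.rescale`). Each non-simple positive root is the sum of exactly
one extraspecial pair, whose first member is simple. So η, taken to be 1 on simple roots, can be
chosen recursively to make all extraspecial constants positive. One numerical table then suffices;
the general signs are the products η(x)η(y)η(x+y).

Determination (`Relations.eq_unsigned`): let x + y have extraspecial decomposition r + s with r
simple. Jacobi for x, y, -r expresses N_{x,y} N_{-r,x+y} by constants with sums of smaller height.
The factors N_{-r,u} follow from N_{r,u-r} by the product formula, and N_{-r,x+y} from the
prescribed N_{r,s}, so induction on the height applies. The constants N_{x,-y} then follow from the
zero-sum relation for x, y - x, -y. Outside the tables the sum is not a root, hence the constant is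
zero. -/

/-- A comparison of quadruples that is fast to evaluate. -/
instance : DecidableEq Quad := fun x y ↦
  decidable_of_iff (x 0 = y 0 ∧ x 1 = y 1 ∧ x 2 = y 2 ∧ x 3 = y 3)
    ⟨fun ⟨h₀, h₁, h₂, h₃⟩ ↦ funext fun i ↦ by fin_cases i <;> assumption,
      fun h ↦ by simp [h]⟩

/-! ### The root system of type F₄ in coordinates -/

/-- The positive roots of `F₄`. -/
def positiveRoots : List Quad :=
  [![0, 0, 0, 1], ![0, 0, 1, 0], ![0, 0, 1, 1], ![0, 1, 0, 0], ![0, 1, 1, 0], ![0, 1, 1, 1],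
    ![0, 1, 2, 0], ![0, 1, 2, 1], ![0, 1, 2, 2], ![1, 0, 0, 0], ![1, 1, 0, 0], ![1, 1, 1, 0],
    ![1, 1, 1, 1], ![1, 1, 2, 0], ![1, 1, 2, 1], ![1, 1, 2, 2], ![1, 2, 2, 0], ![1, 2, 2, 1],
    ![1, 2, 2, 2], ![1, 2, 3, 1], ![1, 2, 3, 2], ![1, 2, 4, 2], ![1, 3, 4, 2], ![2, 3, 4, 2]]

/-- The roots of `F₄`. -/
def rootList : List Quad := positiveRoots ++ positiveRoots.map (-·)

/-- The simple root with the label `k`. -/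
def simple (k : Fin 4) : Quad := Pi.single k 1

/-- Half the squared lengths of the simple roots. -/
def halfSq : Fin 4 → ℤ := ![2, 2, 1, 1]

/-- The inner product of the simple root `k` with `x`. -/
def innerSimple (k : Fin 4) (x : Quad) : ℤ := ∑ j, CartanMatrix.F₄ k j * halfSq j * x j

/-- The Cartan integer `2 (a, x) / (x, x)` for the simple root `a` labelled `k`. -/
def simplePairing (k : Fin 4) (x : Quad) : ℤ :=
  2 * innerSimple k x / ∑ i, x i * innerSimple i x

/-- The Cartan integer `2 (u, x) / (x, x)`. -/
def cartanInt (u x : Quad) : ℤ := ∑ k, u k * simplePairing k x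

/-- The sum of the coefficients. -/
def ht (x : Quad) : ℤ := ∑ i, x i

/-- The reflection in the simple root `k`. -/
def reflect (k : Fin 4) (x : Quad) : Quad :=
  x - (∑ i, x i * CartanMatrix.F₄ i k) • simple k

instance (x y : Quad) : Decidable (Prec x y) :=
  inferInstanceAs (Decidable (∃ i, (∀ j < i, y j - x j = 0) ∧ 0 < y i - x i))

/-- The reflection step of the induction that generates all roots. The formula for the Cartan
integers also confirms that the integer division in `simplePairing` gives the right values on the
orbit. -/
lemma reflect_mem_rootList : ∀ x ∈ rootList, ∀ k, reflect k x ∈ rootList ∧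
    ∀ l, simplePairing l (reflect k x) =
      simplePairing l x - CartanMatrix.F₄ l k * simplePairing k x := by
  decide +kernel

lemma simple_mem_rootList : ∀ k, simple k ∈ rootList ∧
    ∀ l, simplePairing l (simple k) = CartanMatrix.F₄ l k := by
  decide +kernel

lemma neg_mem_rootList : ∀ x ∈ rootList, -x ∈ rootList ∧
    ∀ l, simplePairing l (-x) = -simplePairing l x := by
  decide +kernel

/-- The descent that shows each listed quadruple to be a root: reflections run backwards from a
simple root. -/
lemma exists_reflect_lt : ∀ x ∈ positiveRoots, (∃ k, x = simple k) ∨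
    ∃ k, reflect k x ∈ positiveRoots ∧ ht (reflect k x) < ht x := by
  decide +kernel

lemma ht_pos : ∀ x ∈ positiveRoots, 0 < ht x := by decide +kernel

lemma prec_zero_iff : ∀ x ∈ rootList, Prec 0 x ↔ x ∈ positiveRoots := by decide +kernel

lemma zero_notMem_rootList : (0 : Quad) ∉ rootList := by decide +kernel

/-! ### Identification of the roots of the Lie algebra with the list -/

section Roots

variable {L : Type*} [LieRing L] [LieAlgebra ℂ L] [FiniteDimensional ℂ L] [IsKilling ℂ L]
variable {H : LieSubalgebra ℂ L} [H.IsCartanSubalgebra]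
variable {B : (rootSystem H).Base} {p : Fin 4 ≃ B.support}

lemma toDual_add (x y : Quad) : toDual p (x + y) = toDual p x + toDual p y := by
  simp [toDual, add_smul, Finset.sum_add_distrib]

lemma toDual_neg (x : Quad) : toDual p (-x) = -toDual p x := by
  simp [toDual]

lemma toDual_sub (x y : Quad) : toDual p (x - y) = toDual p x - toDual p y := by
  rw [sub_eq_add_neg, toDual_add, toDual_neg, ← sub_eq_add_neg]

lemma toDual_zsmul (m : ℤ) (x : Quad) : toDual p (m • x) = m • toDual p x := by
  simp [toDual, Finset.smul_sum, smul_smul]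

lemma toDual_simple (k : Fin 4) : toDual p (simple k) = (rootSystem H).root (p k) := by
  simp [toDual, simple, Pi.single_apply]

lemma toDual_injective : Function.Injective (toDual p) := by
  have h : LinearIndependent ℤ fun i : B.support ↦ (rootSystem H).root i :=
    B.linearIndepOn_root.restrict_scalars' ℤ
  have h' := h.comp p p.injective
  rw [Fintype.linearIndependent_iff] at h'
  intro x y hxy
  rw [← sub_eq_zero, ← toDual_sub] at hxy
  funext i
  exact sub_eq_zero.mp (h' (x - y) hxy i)

lemma pairing_simple (hp : IsTypeF4 p) (i k : Fin 4) :
    (rootSystem H).pairing (p i) (p k) = (CartanMatrix.F₄ i k : ℂ) := by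
  rw [← hp i k]
  exact (B.algebraMap_cartanMatrixIn_apply ℤ (p i) (p k)).symm

/-- Every root is given by a quadruple in the list, with the expected Cartan integers. -/
lemma exists_quad (hp : IsTypeF4 p) (r : H.root) : ∃ x ∈ rootList,
    (rootSystem H).root r = toDual p x ∧
      ∀ k, (rootSystem H).pairing (p k) r = (simplePairing k x : ℂ) := by
  induction r using B.induction_reflect with
  | h₀ r h =>
    obtain ⟨x, hx, hr, hk⟩ := h
    refine ⟨-x, (neg_mem_rootList x hx).1, ?_, fun k ↦ ?_⟩
    · rw [toDual_neg, ← hr, RootPairing.root_reflectionPerm, RootPairing.reflection_apply_self]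
    · rw [RootPairing.pairing_reflectionPerm_self_right, hk, (neg_mem_rootList x hx).2]
      push_cast
      rfl
  | h₁ r h =>
    obtain ⟨k, hk⟩ := p.surjective ⟨r, h⟩
    obtain rfl : (p k : H.root) = r := congrArg Subtype.val hk
    refine ⟨simple k, (simple_mem_rootList k).1, (toDual_simple k).symm, fun l ↦ ?_⟩
    rw [pairing_simple hp, (simple_mem_rootList k).2]
  | h₂ r s h hs =>
    obtain ⟨x, hx, hr, hk⟩ := h
    obtain ⟨k, hks⟩ := p.surjective ⟨s, hs⟩
    obtain rfl : (p k : H.root) = s := congrArg Subtype.val hks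
    have hpair : (rootSystem H).pairing r (p k) =
        ((∑ i, x i * CartanMatrix.F₄ i k : ℤ) : ℂ) := by
      rw [RootPairing.pairing, RootPairing.root', hr, toDual]
      simp only [map_sum, LinearMap.sum_apply, map_zsmul, LinearMap.smul_apply,
        RootPairing.root_coroot_eq_pairing, pairing_simple hp]
      simp
    refine ⟨reflect k x, (reflect_mem_rootList x hx k).1, ?_, fun l ↦ ?_⟩
    · rw [RootPairing.root_reflectionPerm, RootPairing.reflection_apply_root, hpair, reflect,
        toDual_sub, toDual_zsmul, toDual_simple, hr, Int.cast_smul_eq_zsmul]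
    -- The reflection is moved from the coroot to the simple root `p l`, where it is given by the
    -- Cartan matrix.
    · rw [RootPairing.pairing_reflectionPerm]
      have : (rootSystem H).pairing ((rootSystem H).reflectionPerm (p k) (p l)) r =
          (rootSystem H).pairing (p l) r -
            (rootSystem H).pairing (p l) (p k) * (rootSystem H).pairing (p k) r := by
        simp only [← RootPairing.root_coroot_eq_pairing, RootPairing.root_reflectionPerm,
          RootPairing.reflection_apply_root]
        simp
      rw [this, hk, hk, pairing_simple hp, (reflect_mem_rootList x hx k).2]
      push_cast
      rfl

lemma IsRoot.mem (hp : IsTypeF4 p) {x : Quad} (h : IsRoot p x) : x ∈ rootList := by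
  obtain ⟨r, hr⟩ := h
  obtain ⟨y, hy, hry, -⟩ := exists_quad hp r
  rwa [toDual_injective (hr.symm.trans hry)]

lemma isRoot_neg {x : Quad} (h : IsRoot p x) : IsRoot p (-x) := by
  obtain ⟨r, hr⟩ := h
  refine ⟨(rootSystem H).reflectionPerm r r, ?_⟩
  rw [toDual_neg, ← hr, RootPairing.root_reflectionPerm, RootPairing.reflection_apply_self]

lemma isRoot_of_reflect (hp : IsTypeF4 p) {k : Fin 4} {x : Quad} (h : IsRoot p (reflect k x)) :
    IsRoot p x := by
  obtain ⟨r, hr⟩ := h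
  refine ⟨(rootSystem H).reflectionPerm (p k) r, ?_⟩
  -- The coordinate reflection agrees with the true one on all of the lattice, so it applies to `x`
  -- before `x` is known to be a root; reflecting twice then recovers `x`.
  have hx : (rootSystem H).reflection (p k) (toDual p x) = toDual p (reflect k x) := by
    rw [reflect, toDual_sub, toDual_zsmul, toDual_simple, RootPairing.reflection_apply,
      ← Int.cast_smul_eq_zsmul ℂ]
    congr 2
    rw [RootPairing.coroot', toDual]
    simp only [map_sum, map_zsmul]
    have (i : Fin 4) : (p i : H.root).1 (coroot (p k : H.root).1) = (CartanMatrix.F₄ i k : ℂ) :=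
      pairing_simple hp i k
    simp [this]
  rw [RootPairing.root_reflectionPerm, hr, ← hx, RootPairing.reflection_same]

lemma isRoot_of_mem_positiveRoots (hp : IsTypeF4 p) (m : ℕ) :
    ∀ x ∈ positiveRoots, (ht x).toNat = m → IsRoot p x := by
  induction m using Nat.strong_induction_on with
  | _ m ih =>
    rintro x hx rfl
    obtain ⟨k, rfl⟩ | ⟨k, hk, hlt⟩ := exists_reflect_lt x hx
    · exact ⟨p k, (toDual_simple k).symm⟩
    · have := ht_pos _ hk
      exact isRoot_of_reflect hp (ih _ (by lia) _ hk rfl)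

lemma isRoot_iff (hp : IsTypeF4 p) {x : Quad} : IsRoot p x ↔ x ∈ rootList := by
  refine ⟨IsRoot.mem hp, fun h ↦ ?_⟩
  rw [rootList, List.mem_append, List.mem_map] at h
  rcases h with h | ⟨y, hy, rfl⟩
  · exact isRoot_of_mem_positiveRoots hp _ x h rfl
  · exact isRoot_neg (isRoot_of_mem_positiveRoots hp _ y hy rfl)

/-- A quadruple in the list is a root with the expected Cartan integers. -/
lemma exists_root (hp : IsTypeF4 p) {x : Quad} (hx : x ∈ rootList) : ∃ r : H.root,
    (rootSystem H).root r = toDual p x ∧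
      ∀ u, toDual p u ((rootSystem H).coroot r) = (cartanInt u x : ℂ) := by
  obtain ⟨r, hr⟩ := (isRoot_iff hp).mpr hx
  obtain ⟨y, hy, hry, hk⟩ := exists_quad hp r
  obtain rfl := toDual_injective (hr.symm.trans hry)
  refine ⟨r, hr, fun u ↦ ?_⟩
  have (k : Fin 4) :
      (rootSystem H).root (p k) ((rootSystem H).coroot r) = (simplePairing k x : ℂ) := hk k
  simp only [toDual, LinearMap.sum_apply, LinearMap.smul_apply, this, cartanInt]
  simp

end Roots

/-! ### Identities between structure constants -/

/-- The relations satisfied by the structure constants of a simple Lie algebra of type `F₄`,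
as a function of quadruples. -/
structure Relations (n : Quad → Quad → ℂ) : Prop where
  eq_zero : ∀ x ∈ rootList, ∀ y ∈ rootList, x + y ∉ rootList → n x y = 0
  antisymm : ∀ x ∈ rootList, ∀ y ∈ rootList, n y x = -n x y
  string : ∀ x ∈ rootList, ∀ y ∈ rootList, x + y ≠ 0 → y - x ≠ 0 →
    n x y * n (-x) (x + y) = n (-x) y * n x (y - x) - cartanInt y x
  jacobi : ∀ x ∈ rootList, ∀ y ∈ rootList, ∀ z ∈ rootList, x + y + z ∈ rootList →
    x + y ≠ 0 → y + z ≠ 0 → z + x ≠ 0 →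
    n y z * n x (y + z) + n z x * n y (z + x) + n x y * n z (x + y) = 0
  triangle : ∀ x ∈ rootList, ∀ y ∈ rootList, ∀ z ∈ rootList, x + y + z = 0 →
    ∀ k, n y z * simplePairing k x + n z x * simplePairing k y + n x y * simplePairing k z = 0

section Brackets

variable {L : Type*} [LieRing L] [LieAlgebra ℂ L] [FiniteDimensional ℂ L] [IsKilling ℂ L]
variable {H : LieSubalgebra ℂ L} [H.IsCartanSubalgebra]

lemma IsRootVectors.mem {e : Module.Dual ℂ H → L} (he : IsRootVectors H e)
    {f : Module.Dual ℂ H} (hf : f ∈ roots H) : e f ∈ rootSpace H f := by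
  obtain ⟨r, rfl⟩ := hf
  exact he.mem_rootSpace r

/-- A zero root vector would make the coroot [e_r, e_{-r}] vanish. This is what allows coefficients
of root vectors to be compared. -/
lemma IsRootVectors.ne_zero {e : Module.Dual ℂ H → L} (he : IsRootVectors H e)
    {f : Module.Dual ℂ H} (hf : f ∈ roots H) : e f ≠ 0 := by
  obtain ⟨r, rfl⟩ := hf
  intro h
  have := he.lie_neg r
  rw [h, zero_lie] at this
  exact (rootSystem H).ne_zero' r (Subtype.ext this.symm)

/-- The bracket of root spaces vanishes if the sum of the roots is neither a root nor zero. -/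
lemma lie_eq_zero_of_add_notMem_roots {f g : Module.Dual ℂ H} (h : f + g ∉ roots H)
    (h₀ : f + g ≠ 0) {u v : L} (hu : u ∈ rootSpace H f) (hv : v ∈ rootSpace H g) :
    ⁅u, v⁆ = 0 := by
  have huv : ⁅u, v⁆ ∈ rootSpace H (f + g : Module.Dual ℂ H) :=
    lie_mem_genWeightSpace_of_mem_genWeightSpace hu hv
  by_contra hne
  have hbot : rootSpace H (f + g : Module.Dual ℂ H) ≠ ⊥ := by
    intro hb
    rw [hb] at huv
    exact hne (by simpa using huv)
  let w : LieModule.Weight ℂ H L := ⟨_, hbot⟩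
  have hw : w.IsNonZero := fun hz ↦ h₀ (LinearMap.ext fun t ↦ congrFun hz t)
  exact h ⟨⟨w, by simpa using hw⟩, LinearMap.ext fun t ↦ rfl⟩

variable {B : (rootSystem H).Base} {p : Fin 4 ≃ B.support}
variable {e : Module.Dual ℂ H → L} {N : Module.Dual ℂ H → Module.Dual ℂ H → ℂ}

lemma lie_toDual (hp : IsTypeF4 p) (he : IsRootVectors H e) (hN : IsStructureConstants H e N)
    {x y : Quad} (hx : x ∈ rootList) (hy : y ∈ rootList) (h : x + y ≠ 0) :
    ⁅e (toDual p x), e (toDual p y)⁆ =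
      N (toDual p x) (toDual p y) • e (toDual p (x + y)) := by
  have hx' := (isRoot_iff hp).mpr hx
  have hy' := (isRoot_iff hp).mpr hy
  rw [toDual_add]
  by_cases hxy : toDual p x + toDual p y ∈ roots H
  · exact hN.lie_eq _ hx' _ hy' hxy
  · rw [hN.eq_zero _ hx' _ hy' hxy, zero_smul]
    refine lie_eq_zero_of_add_notMem_roots hxy (fun h0 ↦ h ?_) (he.mem hx') (he.mem hy')
    apply toDual_injective (p := p)
    rw [toDual_add, h0]
    simp [toDual]

/-- The coroot of a root, given together with its action on the root vectors. -/
lemma exists_lie_neg (hp : IsTypeF4 p) (he : IsRootVectors H e) {x : Quad} (hx : x ∈ rootList) :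
    ∃ h : H, ⁅e (toDual p x), e (toDual p (-x))⁆ = (h : L) ∧
      (∀ u, toDual p u h = (cartanInt u x : ℂ)) ∧
      ∀ u ∈ rootList, ⁅(h : L), e (toDual p u)⁆ = (cartanInt u x : ℂ) • e (toDual p u) := by
  obtain ⟨r, hr, hu⟩ := exists_root hp hx
  refine ⟨(rootSystem H).coroot r, ?_, hu, fun u hmem ↦ ?_⟩
  · rw [toDual_neg, ← hr, he.lie_neg]
  · rw [← hu]
    exact lie_eq_smul_of_mem_rootSpace (he.mem ((isRoot_iff hp).mpr hmem)) _

lemma cartanInt_simple (k : Fin 4) (x : Quad) : cartanInt (simple k) x = simplePairing k x := by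
  simp [cartanInt, simple, Pi.single_apply]

/-- The structure constants of a simple Lie algebra of type `F₄` satisfy the relations. -/
lemma relations (hp : IsTypeF4 p) (he : IsRootVectors H e) (hN : IsStructureConstants H e N) :
    Relations fun x y ↦ N (toDual p x) (toDual p y) := by
  have hbr {x y : Quad} := @lie_toDual _ _ _ _ _ _ _ _ _ _ _ hp he hN x y
  have hne {x : Quad} (hx : x ∈ rootList) : e (toDual p x) ≠ 0 :=
    he.ne_zero ((isRoot_iff hp).mpr hx)
  have hz : ∀ x ∈ rootList, ∀ y ∈ rootList, x + y ∉ rootList →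
      N (toDual p x) (toDual p y) = 0 := by
    intro x hx y hy hxy
    refine hN.eq_zero _ ((isRoot_iff hp).mpr hx) _ ((isRoot_iff hp).mpr hy) ?_
    rw [← toDual_add]
    exact fun h ↦ hxy (IsRoot.mem hp h)
  have hanti : ∀ x ∈ rootList, ∀ y ∈ rootList,
      N (toDual p y) (toDual p x) = -N (toDual p x) (toDual p y) := by
    intro x hx y hy
    by_cases hxy : x + y ∈ rootList
    · have h0 : x + y ≠ 0 := fun h ↦ zero_notMem_rootList (h ▸ hxy)
      have h1 := hbr hx hy h0
      rw [← lie_skew, hbr hy hx (by rwa [add_comm]), add_comm y x, ← neg_smul] at h1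
      rw [← smul_left_injective ℂ (hne hxy) h1, neg_neg]
    · rw [hz x hx y hy hxy, hz y hy x hx (by rwa [add_comm]), neg_zero]
  -- brackets with a product that may vanish
  have hbr₂ {x y z : Quad} (hx : x ∈ rootList) (hy : y ∈ rootList) (hz' : z ∈ rootList)
      (hyz : y + z ≠ 0) (hxyz : x + y + z ≠ 0) :
      ⁅e (toDual p x), ⁅e (toDual p y), e (toDual p z)⁆⁆ =
        (N (toDual p y) (toDual p z) * N (toDual p x) (toDual p (y + z))) •
          e (toDual p (x + y + z)) := by
    -- If `y + z` is not a root, the second factor carries no information, but the first one is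
    -- zero, so the product is still correct.
    rw [hbr hy hz' hyz, lie_smul]
    by_cases h : y + z ∈ rootList
    · rw [hbr hx h (by rwa [← add_assoc]), smul_smul, add_assoc]
    · rw [hz y hy z hz' h, zero_smul, zero_mul, zero_smul]
  refine ⟨hz, hanti, ?_, ?_, ?_⟩
  · intro x hx y hy hxy hyx
    have hx' := (neg_mem_rootList x hx).1
    obtain ⟨h, hh, -, hact⟩ := exists_lie_neg hp he hx
    -- Jacobi for e_{-x}, e_x, e_y: the inner bracket [e_{-x}, e_x] is minus the coroot of `x`,
    -- which acts on e_y by the Cartan integer.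
    have key := leibniz_lie (e (toDual p (-x))) (e (toDual p x)) (e (toDual p y))
    have e1 : -x + x + y = y := by abel
    have e2 : x + -x + y = y := by abel
    have hy0 : y ≠ 0 := fun h ↦ zero_notMem_rootList (h ▸ hy)
    rw [hbr₂ hx' hx hy hxy (by rwa [e1]), hbr₂ hx hx' hy (by rwa [neg_add_eq_sub]) (by rwa [e2]),
      ← lie_skew (e (toDual p (-x))), hh, neg_lie, hact y hy, e1, e2, ← neg_smul, ← add_smul] at key
    have := smul_left_injective ℂ (hne hy) key
    rw [this, neg_add_eq_sub, neg_add_eq_sub]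
  · intro x hx y hy z hz' hxyz h1 h2 h3
    have h0 : x + y + z ≠ 0 := fun h ↦ zero_notMem_rootList (h ▸ hxyz)
    have e1 : y + z + x = x + y + z := by abel
    have e2 : z + x + y = x + y + z := by abel
    have key := lie_jacobi (e (toDual p x)) (e (toDual p y)) (e (toDual p z))
    rw [hbr₂ hx hy hz' h2 h0, hbr₂ hy hz' hx h3 (by rwa [e1]), hbr₂ hz' hx hy h1 (by rwa [e2]),
      e1, e2, ← add_smul, ← add_smul] at key
    exact (smul_eq_zero.mp key).resolve_right (hne hxyz)
  · intro x hx y hy z hz' h0 k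
    have hpart {x y z : Quad} (hx : x ∈ rootList) (hy : y ∈ rootList) (hz' : z ∈ rootList)
        (h0 : x + y + z = 0) : ∃ h : H, toDual p (simple k) h = (simplePairing k x : ℂ) ∧
          ⁅e (toDual p x), ⁅e (toDual p y), e (toDual p z)⁆⁆ =
            ((N (toDual p y) (toDual p z) • h : H) : L) := by
      obtain ⟨h, hh, hu, -⟩ := exists_lie_neg hp he hx
      have e1 : y + z = -x := by rw [eq_neg_iff_add_eq_zero, ← h0]; abel
      have e2 : y + z ≠ 0 := by
        rw [e1, neg_ne_zero]
        exact fun h ↦ zero_notMem_rootList (h ▸ hx)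
      refine ⟨h, by rw [hu, cartanInt_simple], ?_⟩
      rw [hbr hy hz' e2, e1, lie_smul, hh]
      rfl
    obtain ⟨a, ha, ha'⟩ := hpart hx hy hz' h0
    obtain ⟨b, hb, hb'⟩ := hpart hy hz' hx (by rw [← h0]; abel)
    obtain ⟨c, hc, hc'⟩ := hpart hz' hx hy (by rw [← h0]; abel)
    have key := lie_jacobi (e (toDual p x)) (e (toDual p y)) (e (toDual p z))
    rw [ha', hb', hc', ← AddMemClass.coe_add, ← AddMemClass.coe_add,
      ZeroMemClass.coe_eq_zero] at key
    -- Jacobi for a zero-sum triple is a linear relation between coroots; evaluating the simple root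
    -- `k` on it gives numbers.
    have := congrArg (toDual p (simple k)) key
    simpa only [map_add, map_smul, ha, hb, hc, smul_eq_mul, map_zero] using this

end Brackets

/-! ### Removing the signs by rescaling root vectors -/

/-- Changing the signs of the root vectors preserves the relations. -/
lemma Relations.rescale {n : Quad → Quad → ℂ} (h : Relations n) (η : Quad → ℤˣ)
    (hη : ∀ x, η (-x) = η x) :
    Relations fun x y ↦ ((η x * η y * η (x + y) : ℤˣ) : ℤ) * n x y := by
  obtain ⟨a, ha⟩ : ∃ a : Quad → ℂ, ∀ x, (((η x : ℤˣ) : ℤ) : ℂ) = a x := ⟨_, fun _ ↦ rfl⟩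
  have hsq (x : Quad) : a x * a x = 1 := by
    rw [← ha, ← Int.cast_mul, ← Units.val_mul, Int.units_mul_self]
    simp
  have hneg (x : Quad) : a (-x) = a x := by rw [← ha, ← ha, hη]
  refine ⟨fun x hx y hy hxy ↦ ?_, fun x hx y hy ↦ ?_, fun x hx y hy h₁ h₂ ↦ ?_,
    fun x hx y hy z hz h₀ h₁ h₂ h₃ ↦ ?_, fun x hx y hy z hz h₀ k ↦ ?_⟩
  · rw [h.eq_zero x hx y hy hxy, mul_zero]
  · rw [h.antisymm x hx y hy, add_comm y x, mul_comm (η y), mul_neg]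
  · have key := h.string x hx y hy h₁ h₂
    have e1 : -x + (x + y) = y := by abel
    have e2 : x + (y - x) = y := by abel
    have e3 : -x + y = y - x := by abel
    -- Both products in the string relation pass from `y` to a neighbour `w` and back, so every sign
    -- occurs twice and cancels.
    have hs (w : Quad) : (a x * a y * a w) * (a x * a w * a y) = 1 := by
      linear_combination (a y * a y * a w * a w) * hsq x + (a w * a w) * hsq y + hsq w
    rw [e1, e2, e3]
    push_cast [ha, hneg]
    linear_combination key + (n x y * n (-x) (x + y)) * hs (x + y) -
      (n (-x) y * n x (y - x)) * hs (y - x)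
  · have key := h.jacobi x hx y hy z hz h₀ h₁ h₂ h₃
    have e1 : y + (z + x) = x + y + z := by abel
    have e2 : z + (x + y) = x + y + z := by abel
    have e3 : x + (y + z) = x + y + z := by abel
    rw [e1, e2, e3]
    push_cast [ha]
    linear_combination (a x * a y * a z * a (x + y + z)) * (key +
      (n y z * n x (y + z)) * hsq (y + z) + (n z x * n y (z + x)) * hsq (z + x) +
      (n x y * n z (x + y)) * hsq (x + y))
  · have key := h.triangle x hx y hy z hz h₀ k
    have e1 : y + z = -x := by rw [eq_neg_iff_add_eq_zero, ← h₀]; abel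
    have e2 : z + x = -y := by rw [eq_neg_iff_add_eq_zero, ← h₀]; abel
    have e3 : x + y = -z := by rw [eq_neg_iff_add_eq_zero, ← h₀]
    rw [e1, e2, e3]
    push_cast [ha, hneg]
    linear_combination (a x * a y * a z) * key

/-- The product of the signs `v j i` over the pairs `(j, i)` in a finite set. -/
def signProd (v : Fin 4 → ℕ → ℤˣ) (s : Finset (Fin 4 × ℕ)) : ℤˣ := ∏ t ∈ s, v t.1 t.2

/-- Signs in the intersection occur twice and square to 1. Monomials in the signs can therefore be
compared as finite sets, without knowing the values of `v`. -/
lemma signProd_symmDiff (v : Fin 4 → ℕ → ℤˣ) (s t : Finset (Fin 4 × ℕ)) :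
    signProd v (symmDiff s t) = signProd v s * signProd v t := by
  have h₁ := Finset.prod_sdiff (f := fun t ↦ v t.1 t.2)
    (Finset.inter_subset_left (s₁ := s) (s₂ := t))
  have h₂ := Finset.prod_sdiff (f := fun t ↦ v t.1 t.2)
    (Finset.inter_subset_right (s₁ := s) (s₂ := t))
  rw [Finset.sdiff_inter_self_left] at h₁
  rw [Finset.sdiff_inter_self_right] at h₂
  rw [signProd, signProd, signProd, ← h₁, ← h₂, symmDiff_def, Finset.sup_eq_union,
    Finset.prod_union disjoint_sdiff_sdiff, mul_mul_mul_comm, Int.units_mul_self, mul_one]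

/-- The set of the pairs `(j, i)` that occur an odd number of times for `i` in a list. -/
def oddSet (j : Fin 4) (l : List ℕ) : Finset (Fin 4 × ℕ) :=
  l.foldr (fun i s ↦ symmDiff {(j, i)} s) ∅

lemma sgn_eq_signProd (v : Fin 4 → ℕ → ℤˣ) (j : Fin 4) (l : List ℕ) :
    sgn (v j) l = signProd v (oddSet j l) := by
  induction l with
  | nil => rfl
  | cons i l ih =>
    rw [sgn] at ih ⊢
    rw [oddSet, List.foldr_cons, signProd_symmDiff, List.map_cons, List.prod_cons, Units.val_mul,
      ih, Units.val_mul, oddSet]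
    simp [signProd]

/-- The signs by which the positive roots have to be rescaled in order to make the structure
constants of the extraspecial pairs positive. -/
def rootSigns : List (Quad × Finset (Fin 4 × ℕ)) :=
  [(![0, 0, 1, 1], {(0, 1)}),
    (![0, 1, 1, 0], {(1, 1)}),
    (![0, 1, 1, 1], {(0, 2), (1, 1)}),
    (![0, 1, 2, 0], {(1, 1), (1, 2)}),
    (![0, 1, 2, 1], {(0, 3), (1, 1), (1, 2)}),
    (![0, 1, 2, 2], {(0, 3), (0, 4), (1, 1), (1, 2)}),
    (![1, 1, 0, 0], {(2, 1)}),
    (![1, 1, 1, 0], {(1, 3), (2, 1)}),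
    (![1, 1, 1, 1], {(0, 5), (1, 3), (2, 1)}),
    (![1, 1, 2, 0], {(1, 3), (1, 4), (2, 1)}),
    (![1, 1, 2, 1], {(0, 6), (1, 3), (1, 4), (2, 1)}),
    (![1, 1, 2, 2], {(0, 6), (0, 7), (1, 3), (1, 4), (2, 1)}),
    (![1, 2, 2, 0], {(1, 3), (1, 4), (2, 1), (2, 2)}),
    (![1, 2, 2, 1], {(0, 8), (1, 3), (1, 4), (2, 1), (2, 2)}),
    (![1, 2, 2, 2], {(0, 8), (0, 9), (1, 3), (1, 4), (2, 1), (2, 2)}),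
    (![1, 2, 3, 1], {(0, 8), (1, 3), (1, 4), (1, 5), (2, 1), (2, 2)}),
    (![1, 2, 3, 2], {(0, 0), (0, 8), (1, 3), (1, 4), (1, 5), (2, 1), (2, 2)}),
    (![1, 2, 4, 2], {(0, 0), (0, 8), (1, 3), (1, 4), (1, 5), (1, 6), (2, 1), (2, 2)}),
    (![1, 3, 4, 2], {(0, 0), (0, 8), (1, 3), (1, 4), (1, 5), (1, 6), (2, 1), (2, 2), (2, 3)}),
    (![2, 3, 4, 2],
      {(0, 0), (0, 8), (1, 3), (1, 4), (1, 5), (1, 6), (2, 1), (2, 2), (2, 3), (3, 1)})]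

/-- The signs attached to a root. They do not change if the root is replaced by its negative. -/
def signSet (x : Quad) : Finset (Fin 4 × ℕ) :=
  symmDiff ((rootSigns.lookup x).getD ∅) ((rootSigns.lookup (-x)).getD ∅)

lemma signSet_neg (x : Quad) : signSet (-x) = signSet x := by
  rw [signSet, signSet, neg_neg, symmDiff_comm]

/-- The signs that occur in the structure constant `N_{x,y}`. -/
def pairSignSet (x y : Quad) : Finset (Fin 4 × ℕ) :=
  symmDiff (symmDiff (signSet x) (signSet y)) (signSet (x + y))

/-- The integer `c` times the product of the signs in `s`. -/
def signed (v : Fin 4 → ℕ → ℤˣ) (t : ℤ × Finset (Fin 4 × ℕ)) : ℤ := t.1 * signProd v t.2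

lemma sgn_eq_signed (v : Fin 4 → ℕ → ℤˣ) (j : Fin 4) (l : List ℕ) :
    sgn (v j) l = signed v (1, oddSet j l) := by
  rw [sgn_eq_signProd, signed, one_mul]

lemma signed_mul (v : Fin 4 → ℕ → ℤˣ) (s t : ℤ × Finset (Fin 4 × ℕ)) :
    signed v s * signed v t = signed v (s.1 * t.1, symmDiff s.2 t.2) := by
  simp only [signed, signProd_symmDiff, Units.val_mul]
  ring

lemma neg_signed (v : Fin 4 → ℕ → ℤˣ) (s : ℤ × Finset (Fin 4 × ℕ)) :
    -signed v s = signed v (-s.1, s.2) := by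
  simp only [signed]
  ring

lemma two_mul_signed (v : Fin 4 → ℕ → ℤˣ) (s : ℤ × Finset (Fin 4 × ℕ)) :
    2 * signed v s = signed v (2 * s.1, s.2) := by
  simp only [signed]
  ring

/-- The third entry of the first triple in a table that starts with `x`, `y`. -/
def value (T : List (Quad × Quad × ℤ)) (x y : Quad) : ℤ :=
  ((T.find? fun t ↦ t.1 = x ∧ t.2.1 = y).map (·.2.2)).getD 0

/-- The table of all structure constants of special pairs. -/
def specialTable (ε δ γ α : ℕ → ℤˣ) : List (Quad × Quad × ℤ) :=
  extraspecialTable ε δ γ α ++ positiveTable ε δ γ α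

/-- The structure constants of special pairs when all signs are positive. -/
def unsignedTable : List (Quad × Quad × ℤ) := specialTable 1 1 1 1

-- The sign of each entry is η(x)η(y)η(x+y), with η read off from `rootSigns`; hence the whole table
-- is a rescaling of the one with all signs positive. Each entry is normalised to an integer and a
-- set of signs, which evaluation compares.
set_option maxRecDepth 10000 in
lemma specialTable_eq_signed (v : Fin 4 → ℕ → ℤˣ) :
    ∀ t ∈ specialTable (v 0) (v 1) (v 2) (v 3),
      t.2.2 = signed v (value unsignedTable t.1 t.2.1, pairSignSet t.1 t.2.1) := by
  simp only [specialTable, extraspecialTable, positiveTable, List.forall_mem_append]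
  repeat' apply And.intro
  all_goals
    simp only [row, List.forall_mem_map, List.forall_mem_cons, sgn_eq_signed v, signed_mul,
      neg_signed, two_mul_signed]
    repeat' apply And.intro
  all_goals first
    | exact List.forall_mem_nil _
    | exact congrArg (signed v) (by decide +kernel)

/-- The structure constants `N_{x,-y}` when all signs are positive. -/
def unsignedNegativeTable : List (Quad × Quad × ℤ) := negativeTable 1 1 1 1

set_option maxRecDepth 10000 in
set_option maxHeartbeats 1000000 in
lemma negativeTable_eq_signed (v : Fin 4 → ℕ → ℤˣ) :
    ∀ t ∈ negativeTable (v 0) (v 1) (v 2) (v 3),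
      t.2.2 = signed v (value unsignedNegativeTable t.1 t.2.1, pairSignSet t.1 (-t.2.1)) := by
  delta negativeTable
  simp only [List.forall_mem_append]
  repeat' apply And.intro
  all_goals
    simp only [row, List.forall_mem_map, List.forall_mem_cons, sgn_eq_signed v, signed_mul,
      neg_signed, two_mul_signed]
    repeat' apply And.intro
  all_goals first
    | exact List.forall_mem_nil _
    | exact congrArg (signed v) (by decide +kernel)

/-! ### Constants determined by the extraspecial pairs -/

/-- The structure constant `N_{x,y}` of two positive roots when all signs are positive. -/
def unsigned (x y : Quad) : ℤ := value unsignedTable x y - value unsignedTable y x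

/-- The product `N_{x,y} N_{-x,x+y}`, computed from the root string through `y`. -/
def stringProd (x y : Quad) : ℤ :=
  -cartanInt y x - if y - x ∈ rootList then cartanInt (y - x) x else 0

/-- The structure constant `N_{-r,y}` for a simple root `r` when all signs are positive. -/
def lowered (r y : Quad) : ℤ :=
  if y - r ∈ rootList then stringProd r (y - r) / unsigned r (y - r) else 0

/-- The pairs of quadruples for which a table has an entry. -/
def pairs (T : List (Quad × Quad × ℤ)) : List (Quad × Quad) := T.map fun t ↦ (t.1, t.2.1)

/-- Root strings in F₄ contain at most three roots. The recursion along the string behind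
`stringProd` therefore stops after one step down. -/
lemma string_length_le : ∀ x ∈ positiveRoots, ∀ y ∈ positiveRoots, y ≠ x → x + y ∈ rootList →
    y - x ∈ rootList → y - x - x ∉ rootList ∧ y - x - x ≠ 0 := by
  decide +kernel

lemma mem_rootList_of_mem_positiveRoots {x : Quad} (hx : x ∈ positiveRoots) : x ∈ rootList :=
  List.mem_append_left _ hx

/-- Ensures that the integer division in `lowered` is exact and its divisor nonzero. -/
lemma lowered_spec : ∀ k, ∀ y ∈ positiveRoots, y ≠ simple k → y - simple k ∈ rootList →
    y - simple k ∈ positiveRoots ∧ y - simple k ≠ simple k ∧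
    unsigned (simple k) (y - simple k) ≠ 0 ∧
    unsigned (simple k) (y - simple k) * lowered (simple k) y =
      stringProd (simple k) (y - simple k) := by
  decide +kernel

lemma simple_mem_positiveRoots : ∀ k, simple k ∈ positiveRoots := by decide +kernel

lemma unsigned_eq_zero : ∀ x ∈ positiveRoots, ∀ y ∈ positiveRoots, x + y ∉ rootList →
    unsigned x y = 0 := by
  decide +kernel

set_option synthInstance.maxHeartbeats 400000 in
set_option synthInstance.maxSize 1000 in
/-- Jacobi's identity determines the structure constants of the pairs which are not extraspecial
by those of the pairs whose sum has a smaller height. -/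
lemma unsigned_jacobi : ∀ x ∈ positiveRoots, ∀ y ∈ positiveRoots, x + y ∈ rootList →
    (x, y) ∈ pairs (extraspecialTable 1 1 1 1) ∨ (y, x) ∈ pairs (extraspecialTable 1 1 1 1) ∨
    ∃ k, x ≠ simple k ∧ y ≠ simple k ∧ x + y ≠ simple k ∧ x + y ∈ positiveRoots ∧
      (simple k, x + y - simple k) ∈ pairs (extraspecialTable 1 1 1 1) ∧
      x + y - simple k ∈ rootList ∧ lowered (simple k) (x + y) ≠ 0 ∧
      lowered (simple k) x * unsigned y (x - simple k) -
        lowered (simple k) y * unsigned x (y - simple k) +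
        unsigned x y * lowered (simple k) (x + y) = 0 := by
  decide +kernel

lemma unsigned_of_mem : ∀ t ∈ extraspecialTable 1 1 1 1, unsigned t.1 t.2.1 = t.2.2 := by
  decide +kernel

/-- Cramer's rule for the zero-sum triple x, y - x, -y. The coroots of x and y - x are linearly
independent, so some pair of simple roots `j`, `k` gives a nonzero minor; the equation is the
resulting solution for N_{x,-y}. -/
lemma unsignedNegativeTable_spec : ∀ t ∈ unsignedNegativeTable,
    t.1 ∈ positiveRoots ∧ t.2.1 ∈ positiveRoots ∧ t.2.1 - t.1 ∈ positiveRoots ∧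
    ∃ j k, simplePairing j t.1 * simplePairing k (t.2.1 - t.1) -
        simplePairing k t.1 * simplePairing j (t.2.1 - t.1) ≠ 0 ∧
      (simplePairing j t.1 * simplePairing k (t.2.1 - t.1) -
          simplePairing k t.1 * simplePairing j (t.2.1 - t.1)) * t.2.2 =
        -unsigned t.1 (t.2.1 - t.1) * (simplePairing j t.1 * simplePairing k t.2.1 -
          simplePairing k t.1 * simplePairing j t.2.1) := by
  decide +kernel

lemma Relations.mul_eq_stringProd {n : Quad → Quad → ℂ} (h : Relations n) {x y : Quad}
    (hx : x ∈ positiveRoots) (hy : y ∈ positiveRoots) (hyx : y ≠ x) (hxy : x + y ∈ rootList) :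
    n x y * n (-x) (x + y) = stringProd x y := by
  have hx' := mem_rootList_of_mem_positiveRoots hx
  have hy' := mem_rootList_of_mem_positiveRoots hy
  have hnx := (neg_mem_rootList x hx').1
  have e1 : -x + y = y - x := by abel
  have e2 : -x + (y - x) = y - x - x := by abel
  have e3 : x + (y - x) = y := by abel
  have h0 : x + y ≠ 0 := fun h ↦ zero_notMem_rootList (h ▸ hxy)
  have hy0 : y ≠ 0 := fun h ↦ zero_notMem_rootList (h ▸ hy')
  rw [h.string x hx' y hy' h0 (sub_ne_zero.mpr hyx), stringProd]
  split_ifs with hm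
  · obtain ⟨h1, h2⟩ := string_length_le x hx y hy hyx hxy hm
    -- The string relation one step lower evaluates the remaining product, since `y - x - x` is not
    -- a root.
    have := h.string x hx' (y - x) hm (by rwa [e3]) h2
    rw [h.eq_zero (-x) hnx (y - x) hm (by rwa [e2]), e3] at this
    push_cast
    linear_combination this
  · rw [h.eq_zero (-x) hnx y hy' (by rwa [e1])]
    push_cast
    ring

lemma Relations.eq_lowered {n : Quad → Quad → ℂ} (h : Relations n) {k : Fin 4} {y : Quad}
    (hy : y ∈ positiveRoots) (hyk : y ≠ simple k)
    (hn : y - simple k ∈ rootList →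
      n (simple k) (y - simple k) = unsigned (simple k) (y - simple k)) :
    n (-simple k) y = lowered (simple k) y := by
  have hy' := mem_rootList_of_mem_positiveRoots hy
  have hk := (simple_mem_rootList k).1
  by_cases hm : y - simple k ∈ rootList
  · obtain ⟨h1, h2, h3, h4⟩ := lowered_spec k y hy hyk hm
    have e : simple k + (y - simple k) = y := by abel
    have := h.mul_eq_stringProd (simple_mem_positiveRoots k) h1 h2 (by rwa [e])
    rw [e, hn hm, ← h4, Int.cast_mul] at this
    exact mul_left_cancel₀ (Int.cast_ne_zero.mpr h3) this
  · rw [h.eq_zero _ (neg_mem_rootList _ hk).1 y hy' (by rwa [neg_add_eq_sub]), lowered, if_neg hm,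
      Int.cast_zero]

/-- The structure constants of pairs of positive roots are determined by those of the
extraspecial pairs. -/
lemma Relations.eq_unsigned {n : Quad → Quad → ℂ} (h : Relations n)
    (hext : ∀ t ∈ extraspecialTable 1 1 1 1, n t.1 t.2.1 = t.2.2) (m : ℕ) :
    ∀ x ∈ positiveRoots, ∀ y ∈ positiveRoots, (ht (x + y)).toNat = m → n x y = unsigned x y := by
  have hext' : ∀ x y, (x, y) ∈ pairs (extraspecialTable 1 1 1 1) → n x y = unsigned x y := by
    intro x y hxy
    obtain ⟨t, ht, hk⟩ := List.mem_map.mp hxy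
    obtain ⟨rfl, rfl⟩ := Prod.mk.inj hk
    rw [hext t ht, unsigned_of_mem t ht]
  have ht_add (x y : Quad) : ht (x + y) = ht x + ht y := by simp [ht, Finset.sum_add_distrib]
  induction m using Nat.strong_induction_on with
  | _ m ih =>
  rintro x hx y hy rfl
  have hx' := mem_rootList_of_mem_positiveRoots hx
  have hy' := mem_rootList_of_mem_positiveRoots hy
  have hlt {u w : Quad} (hu : u ∈ positiveRoots) (hw : w ∈ positiveRoots)
      (huw : ht (u + w) < ht (x + y)) : n u w = unsigned u w := by
    have hpu := ht_pos u hu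
    have hpw := ht_pos w hw
    rw [ht_add] at huw
    exact ih _ (by rw [ht_add u w]; lia) u hu w hw rfl
  by_cases hxy : x + y ∈ rootList
  swap
  · rw [h.eq_zero x hx' y hy' hxy, unsigned_eq_zero x hx y hy hxy, Int.cast_zero]
  obtain he | he | ⟨k, hxk, hyk, hxyk, hxy', hke, hkr, hl, heq⟩ := unsigned_jacobi x hx y hy hxy
  · exact hext' x y he
  · rw [h.antisymm y hy' x hx', hext' y x he, unsigned, unsigned]
    push_cast
    ring
  have hk := (simple_mem_rootList k).1
  have hk' := simple_mem_positiveRoots k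
  have hnk := (neg_mem_rootList _ hk).1
  have hkpos := ht_pos _ hk'
  have hterm {u w : Quad} (hu : u ∈ positiveRoots) (hw : w ∈ positiveRoots) (huk : u ≠ simple k)
      (huw : u + w = x + y) : n (-simple k) u = lowered (simple k) u ∧
        n (-simple k) u * n w (u - simple k) =
          lowered (simple k) u * unsigned w (u - simple k) := by
    have hwpos := ht_pos w hw
    have h1 : n (-simple k) u = lowered (simple k) u := by
      refine h.eq_lowered hu huk fun hm ↦ hlt hk' (lowered_spec k u hu huk hm).1 ?_
      rw [← huw, add_sub_cancel, ht_add]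
      lia
    refine ⟨h1, ?_⟩
    by_cases hm : u - simple k ∈ rootList
    · have : n w (u - simple k) = unsigned w (u - simple k) := by
        refine hlt hw (lowered_spec k u hu huk hm).1 ?_
        have e : u + w = w + (u - simple k) + simple k := by abel
        rw [← huw, e, ht_add _ (simple k)]
        lia
      rw [h1, this]
    · rw [h1, lowered, if_neg hm, Int.cast_zero, zero_mul, zero_mul]
  -- The constant needed here has the same total height as the goal, out of reach of the induction
  -- hypothesis; the pair is extraspecial, so its value is given.
  have hsum : n (-simple k) (x + y) = lowered (simple k) (x + y) :=
    h.eq_lowered hxy' hxyk fun _ ↦ hext' _ _ hke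
  have key := h.jacobi x hx' y hy' (-simple k) hnk (by rwa [← sub_eq_add_neg])
    (fun h0 ↦ zero_notMem_rootList (h0 ▸ hxy)) (by rwa [← sub_eq_add_neg, sub_ne_zero])
    (by rwa [neg_add_eq_sub, sub_ne_zero])
  rw [h.antisymm _ hnk y hy', ← sub_eq_add_neg, neg_add_eq_sub, hsum] at key
  have heq' : (lowered (simple k) x * unsigned y (x - simple k) -
      lowered (simple k) y * unsigned x (y - simple k) +
      unsigned x y * lowered (simple k) (x + y) : ℂ) = 0 := by exact_mod_cast heq
  -- The true and the tabulated constants satisfy the same Jacobi equation, in which all other terms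
  -- agree and N_{x,y} has a nonzero coefficient.
  refine mul_right_cancel₀ (Int.cast_ne_zero.mpr hl) ?_
  linear_combination key - heq' - (hterm hx hy hxk rfl).2 + (hterm hy hx hyk (add_comm y x)).2

lemma Relations.eq_unsignedNegativeTable {n : Quad → Quad → ℂ} (h : Relations n)
    (hext : ∀ t ∈ extraspecialTable 1 1 1 1, n t.1 t.2.1 = t.2.2) :
    ∀ t ∈ unsignedNegativeTable, n t.1 (-t.2.1) = t.2.2 := by
  rintro ⟨x, y, c⟩ ht
  obtain ⟨hx, hy, hz, j, k, hne, heq⟩ := unsignedNegativeTable_spec _ ht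
  simp only at hx hy hz hne heq ⊢
  have hx' := mem_rootList_of_mem_positiveRoots hx
  have hz' := mem_rootList_of_mem_positiveRoots hz
  obtain ⟨hy', hneg⟩ := neg_mem_rootList y (mem_rootList_of_mem_positiveRoots hy)
  have hu := h.eq_unsigned hext _ x hx (y - x) hz rfl
  have h₀ : x + (y - x) + -y = 0 := by abel
  have hj := h.triangle x hx' (y - x) hz' (-y) hy' h₀ j
  have hk := h.triangle x hx' (y - x) hz' (-y) hy' h₀ k
  rw [hneg, hu, h.antisymm x hx' (-y) hy'] at hj hk
  have heq' : ((simplePairing j x * simplePairing k (y - x) -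
      simplePairing k x * simplePairing j (y - x)) * c : ℂ) =
        -unsigned x (y - x) * (simplePairing j x * simplePairing k y -
          simplePairing k x * simplePairing j y) := by exact_mod_cast heq
  have hne' : (simplePairing j x * simplePairing k (y - x) -
      simplePairing k x * simplePairing j (y - x) : ℂ) ≠ 0 := by exact_mod_cast hne
  refine mul_left_cancel₀ hne' ?_
  push_cast at hj hk
  -- This combination of the two evaluations eliminates the unknown N_{y-x,-y}.
  linear_combination simplePairing k x * hj - simplePairing j x * hk - heq'

/-! ### Which pairs the tables contain -/

lemma pairs_append (S T : List (Quad × Quad × ℤ)) : pairs (S ++ T) = pairs S ++ pairs T :=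
  List.map_append

lemma pairs_row (r : Quad) (l : List (Quad × ℤ)) :
    pairs (row r l) = l.map fun t ↦ (r, t.1) := by
  simp [pairs, row]

lemma pairs_specialTable (ε δ γ α : ℕ → ℤˣ) :
    pairs (specialTable ε δ γ α) = pairs unsignedTable := by
  delta unsignedTable specialTable extraspecialTable positiveTable
  simp only [pairs_append, pairs_row, List.map_cons, List.map_nil]

lemma pairs_extraspecialTable (ε δ γ α : ℕ → ℤˣ) :
    pairs (extraspecialTable ε δ γ α) = pairs (extraspecialTable 1 1 1 1) := by
  delta extraspecialTable
  simp only [pairs_append, pairs_row, List.map_cons, List.map_nil]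

lemma pairs_negativeTable (ε δ γ α : ℕ → ℤˣ) :
    pairs (negativeTable ε δ γ α) = pairs unsignedNegativeTable := by
  delta unsignedNegativeTable negativeTable
  simp only [pairs_append, pairs_row, List.map_cons, List.map_nil]

lemma mem_pairs {T : List (Quad × Quad × ℤ)} {x y : Quad} :
    (x, y) ∈ pairs T ↔ ∃ c, (x, y, c) ∈ T := by
  simp [pairs]

lemma mem_rootList_iff {x : Quad} : x ∈ rootList ↔ x ∈ positiveRoots ∨ -x ∈ positiveRoots := by
  rw [rootList, List.mem_append, List.mem_map]
  refine or_congr_right ⟨?_, fun h ↦ ⟨-x, h, neg_neg x⟩⟩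
  rintro ⟨y, hy, rfl⟩
  rwa [neg_neg]

lemma not_prec_neg : ∀ x ∈ positiveRoots, ∀ y ∈ positiveRoots, ¬ Prec x (-y) := by
  decide +kernel

lemma mem_pairs_unsignedTable_iff_of_pos : ∀ x ∈ positiveRoots, ∀ y ∈ positiveRoots,
    (x, y) ∈ pairs unsignedTable ↔ x + y ∈ rootList ∧ Prec x y := by
  decide +kernel

lemma mem_pairs_unsignedNegativeTable_iff_of_pos : ∀ x ∈ positiveRoots, ∀ y ∈ positiveRoots,
    (x, y) ∈ pairs unsignedNegativeTable ↔ x + -y ∈ rootList ∧ Prec x y := by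
  decide +kernel

lemma unsignedTable_spec : ∀ t ∈ unsignedTable, t.1 ∈ positiveRoots ∧ t.2.1 ∈ positiveRoots ∧
    value unsignedTable t.1 t.2.1 = t.2.2 ∧ unsigned t.1 t.2.1 = t.2.2 ∧ t.2.2 ≠ 0 := by
  decide +kernel

lemma value_unsignedNegativeTable : ∀ t ∈ unsignedNegativeTable,
    value unsignedNegativeTable t.1 t.2.1 = t.2.2 ∧ t.2.2 ≠ 0 := by
  decide +kernel

/-- Minimality only has to be tested against the finitely many special pairs, so evaluation decides
it. -/
lemma mem_pairs_extraspecialTable : ∀ t ∈ pairs unsignedTable,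
    t ∈ pairs (extraspecialTable 1 1 1 1) ↔
      ∀ u ∈ pairs unsignedTable, u.1 + u.2 = t.1 + t.2 → t.1 = u.1 ∨ Prec t.1 u.1 := by
  decide +kernel

/-- A negative root never follows a positive one, so 0 ≺ x ≺ y forces both roots to be positive. The
other checks then run over positive roots only. -/
lemma rootList_prec_iff {x y : Quad} :
    x ∈ rootList ∧ y ∈ rootList ∧ Prec 0 x ∧ Prec x y ↔
      x ∈ positiveRoots ∧ y ∈ positiveRoots ∧ Prec x y := by
  constructor
  · rintro ⟨hx, hy, h0, hxy⟩
    rw [prec_zero_iff x hx] at h0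
    refine ⟨h0, (mem_rootList_iff.mp hy).resolve_right fun h ↦ ?_, hxy⟩
    exact not_prec_neg x h0 _ h (by rwa [neg_neg])
  · rintro ⟨hx, hy, hxy⟩
    have hx' := mem_rootList_of_mem_positiveRoots hx
    exact ⟨hx', mem_rootList_of_mem_positiveRoots hy, (prec_zero_iff x hx').mpr hx, hxy⟩

lemma mem_pairs_unsignedTable {x y : Quad} : (x, y) ∈ pairs unsignedTable ↔
    x ∈ rootList ∧ y ∈ rootList ∧ x + y ∈ rootList ∧ Prec 0 x ∧ Prec x y := by
  have h := @rootList_prec_iff x y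
  constructor
  · intro hm
    obtain ⟨c, hc⟩ := mem_pairs.mp hm
    obtain ⟨hx, hy, -⟩ := unsignedTable_spec _ hc
    have := (mem_pairs_unsignedTable_iff_of_pos x hx y hy).mp hm
    tauto
  · rintro ⟨hx, hy, hxy, h0, hlt⟩
    obtain ⟨hx', hy', -⟩ := h.mp ⟨hx, hy, h0, hlt⟩
    exact (mem_pairs_unsignedTable_iff_of_pos x hx' y hy').mpr ⟨hxy, hlt⟩

lemma mem_pairs_unsignedNegativeTable {x y : Quad} : (x, y) ∈ pairs unsignedNegativeTable ↔
    x ∈ rootList ∧ y ∈ rootList ∧ x + -y ∈ rootList ∧ Prec 0 x ∧ Prec x y := by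
  have h := @rootList_prec_iff x y
  constructor
  · intro hm
    obtain ⟨c, hc⟩ := mem_pairs.mp hm
    obtain ⟨hx, hy, -⟩ := unsignedNegativeTable_spec _ hc
    have := (mem_pairs_unsignedNegativeTable_iff_of_pos x hx y hy).mp hm
    tauto
  · rintro ⟨hx, hy, hxy, h0, hlt⟩
    obtain ⟨hx', hy', -⟩ := h.mp ⟨hx, hy, h0, hlt⟩
    exact (mem_pairs_unsignedNegativeTable_iff_of_pos x hx' y hy').mpr ⟨hxy, hlt⟩

lemma signed_eq (v : Fin 4 → ℕ → ℤˣ) (c : ℤ) (x y : Quad) :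
    signed v (c, pairSignSet x y) = ((signProd v (signSet x) * signProd v (signSet y) *
      signProd v (signSet (x + y)) : ℤˣ) : ℤ) * c := by
  rw [signed, pairSignSet, signProd_symmDiff, signProd_symmDiff, mul_comm]

/-! ### From the unsigned tables to the prescribed signs -/

/-- The values of structure constants that satisfy the relations, where the signs of the
extraspecial pairs are prescribed. -/
lemma Relations.eq_tables {n : Quad → Quad → ℂ} (h : Relations n) (v : Fin 4 → ℕ → ℤˣ)
    (hext : ∀ t ∈ extraspecialTable (v 0) (v 1) (v 2) (v 3), n t.1 t.2.1 = t.2.2) :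
    (∀ t ∈ specialTable (v 0) (v 1) (v 2) (v 3), n t.1 t.2.1 = t.2.2 ∧ t.2.2 ≠ 0) ∧
      ∀ t ∈ negativeTable (v 0) (v 1) (v 2) (v 3), n t.1 (-t.2.1) = t.2.2 ∧ t.2.2 ≠ 0 := by
  set η : Quad → ℤˣ := fun x ↦ signProd v (signSet x) with hη
  have hrel := h.rescale η fun x ↦ by rw [hη]; simp only [signSet_neg]
  have hsq (x y : Quad) : ((η x * η y * η (x + y) : ℤˣ) : ℤ) *
      ((η x * η y * η (x + y) : ℤˣ) : ℤ) = 1 := by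
    rw [← Units.val_mul, Int.units_mul_self, Units.val_one]
  -- passing between `n` and the rescaled structure constants
  have hiff (x y : Quad) (c : ℤ) : n x y = (signed v (c, pairSignSet x y) : ℤ) ↔
      ((η x * η y * η (x + y) : ℤˣ) : ℤ) * n x y = c := by
    rw [signed_eq]
    have hsq' : (((η x * η y * η (x + y) : ℤˣ) : ℤ) : ℂ) *
      ((η x * η y * η (x + y) : ℤˣ) : ℤ) = 1 := by exact_mod_cast hsq x y
    rw [Int.cast_mul]
    constructor
    · intro hn
      rw [hn, ← mul_assoc, hsq', one_mul]
    · intro hn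
      rw [← hn, ← mul_assoc, hsq', one_mul]
  have hne (x y : Quad) {c : ℤ} (hc : c ≠ 0) : signed v (c, pairSignSet x y) ≠ 0 :=
    mul_ne_zero hc (Units.ne_zero _)
  -- With this η the rescaled constants of the extraspecial pairs are the positive ones, so the
  -- sign-free determination applies to them.
  have hext' : ∀ t ∈ extraspecialTable 1 1 1 1,
      ((η t.1 * η t.2.1 * η (t.1 + t.2.1) : ℤˣ) : ℤ) * n t.1 t.2.1 = t.2.2 := by
    rintro ⟨x, y, c⟩ ht
    have hp := mem_pairs.mpr ⟨c, ht⟩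
    rw [← pairs_extraspecialTable (v 0) (v 1) (v 2) (v 3)] at hp
    obtain ⟨c', ht'⟩ := mem_pairs.mp hp
    have hc := specialTable_eq_signed v _ (List.mem_append_left _ ht')
    have hu : (x, y, c) ∈ unsignedTable := by
      rw [unsignedTable, specialTable]
      exact List.mem_append_left _ ht
    have hv := (unsignedTable_spec _ hu).2.2.1
    simp only at hc hv ⊢
    rw [← hiff, hext _ ht', hc, hv]
  refine ⟨?_, ?_⟩
  · rintro ⟨x, y, c⟩ ht
    have hc := specialTable_eq_signed v _ ht
    have hp := mem_pairs.mpr ⟨c, ht⟩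
    rw [pairs_specialTable] at hp
    obtain ⟨c', ht'⟩ := mem_pairs.mp hp
    obtain ⟨hx, hy, hv, hu, h0⟩ := unsignedTable_spec _ ht'
    simp only at hx hy hv hu h0 hc ⊢
    rw [hc, hv, hiff]
    exact ⟨(hrel.eq_unsigned hext' _ x hx y hy rfl).trans (by rw [hu]), hne x y h0⟩
  · rintro ⟨x, y, c⟩ ht
    have hc := negativeTable_eq_signed v _ ht
    have hp := mem_pairs.mpr ⟨c, ht⟩
    rw [pairs_negativeTable] at hp
    obtain ⟨c', ht'⟩ := mem_pairs.mp hp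
    obtain ⟨hv, h0⟩ := value_unsignedNegativeTable _ ht'
    have hn := hrel.eq_unsignedNegativeTable hext' _ ht'
    simp only at hv h0 hc hn ⊢
    rw [hc, hv, hiff]
    exact ⟨hn, hne x (-y) h0⟩

/-- Membership in a table of the nonzero values of a function `f`. Here `S` is the condition under
which `f` may be nonzero. -/
lemma mem_table_iff {T : List (Quad × Quad × ℤ)} {f : Quad → Quad → ℂ}
    (hT : ∀ t ∈ T, f t.1 t.2.1 = t.2.2 ∧ t.2.2 ≠ 0) {Q S : Quad → Quad → Prop}
    (hpairs : ∀ x y, (x, y) ∈ pairs T ↔ Q x y ∧ S x y)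
    (hf : ∀ x y, Q x y → ¬ S x y → f x y = 0) (x y : Quad) (c : ℤ) :
    (x, y, c) ∈ T ↔ Q x y ∧ f x y = c ∧ c ≠ 0 := by
  constructor
  · intro h
    exact ⟨((hpairs x y).mp (mem_pairs.mpr ⟨c, h⟩)).1, hT _ h⟩
  · rintro ⟨hQ, hc, h0⟩
    have hS : S x y := by
      by_contra hS
      rw [hf x y hQ hS] at hc
      exact h0 (by exact_mod_cast hc.symm)
    obtain ⟨c', h'⟩ := mem_pairs.mp ((hpairs x y).mpr ⟨hQ, hS⟩)
    have : (c : ℂ) = c' := hc.symm.trans (hT _ h').1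
    rwa [Int.cast_injective this]

end F4Table

theorem theorem1 {L : Type*} [LieRing L] [LieAlgebra ℂ L] [FiniteDimensional ℂ L]
    [LieAlgebra.IsSimple ℂ L] (H : LieSubalgebra ℂ L) [H.IsCartanSubalgebra]
    (B : (LieAlgebra.IsKilling.rootSystem H).Base) (p : Fin 4 ≃ B.support)
    (hF4 : F4Table.IsTypeF4 p)
    (e : Module.Dual ℂ H → L) (he : F4Table.IsRootVectors H e)
    (N : Module.Dual ℂ H → Module.Dual ℂ H → ℂ) (hN : F4Table.IsStructureConstants H e N)
    (ε δ γ α : ℕ → ℤˣ)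
    (hext : ∀ x y c, (x, y, c) ∈ F4Table.extraspecialTable ε δ γ α →
      N (F4Table.toDual p x) (F4Table.toDual p y) = c) :
    (∀ x y, F4Table.IsExtraspecial p x y ↔
      ∃ c, (x, y, c) ∈ F4Table.extraspecialTable ε δ γ α) ∧
    (∀ x y c, (x, y, c) ∈ F4Table.extraspecialTable ε δ γ α ++ F4Table.positiveTable ε δ γ α ↔
      F4Table.IsRoot p x ∧ F4Table.IsRoot p y ∧ F4Table.Prec 0 x ∧ F4Table.Prec x y ∧
        N (F4Table.toDual p x) (F4Table.toDual p y) = c ∧ c ≠ 0) ∧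
    (∀ x y c, (x, y, c) ∈ F4Table.negativeTable ε δ γ α ↔
      F4Table.IsRoot p x ∧ F4Table.IsRoot p y ∧ F4Table.Prec 0 x ∧ F4Table.Prec x y ∧
        N (F4Table.toDual p x) (-F4Table.toDual p y) = c ∧ c ≠ 0) := by
  have hrel := F4Table.relations hF4 he hN
  obtain ⟨hpos, hneg⟩ := hrel.eq_tables ![ε, δ, γ, α] fun t ht ↦ hext _ _ _ ht
  have hspecial (x y : F4Table.Quad) :
      F4Table.IsSpecial p x y ↔ (x, y) ∈ F4Table.pairs F4Table.unsignedTable := by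
    simp only [F4Table.IsSpecial, F4Table.isRoot_iff hF4, F4Table.mem_pairs_unsignedTable]
  refine ⟨fun x y ↦ ?_, fun x y c ↦ ?_, fun x y c ↦ ?_⟩
  · rw [← F4Table.mem_pairs, F4Table.pairs_extraspecialTable, F4Table.IsExtraspecial]
    simp only [hspecial]
    constructor
    · rintro ⟨hxy, h⟩
      exact (F4Table.mem_pairs_extraspecialTable _ hxy).mpr fun u hu ↦ h u.1 u.2 hu
    · intro h
      have hxy : (x, y) ∈ F4Table.pairs F4Table.unsignedTable := by
        obtain ⟨c, hc⟩ := F4Table.mem_pairs.mp h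
        refine F4Table.mem_pairs.mpr ⟨c, ?_⟩
        rw [F4Table.unsignedTable, F4Table.specialTable]
        exact List.mem_append_left _ hc
      exact ⟨hxy, fun x' y' ↦ (F4Table.mem_pairs_extraspecialTable _ hxy).mp h (x', y')⟩
  · simp only [F4Table.isRoot_iff hF4]
    -- Completeness: a pair in the given order whose sum is a root lies in the table, and any other
    -- has constant zero.
    refine (F4Table.mem_table_iff (T := F4Table.specialTable ε δ γ α)
      (f := fun x y ↦ N (F4Table.toDual p x) (F4Table.toDual p y)) hpos
      (Q := fun x y ↦ x ∈ F4Table.rootList ∧ y ∈ F4Table.rootList ∧ F4Table.Prec 0 x ∧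
        F4Table.Prec x y) (S := fun x y ↦ x + y ∈ F4Table.rootList) (fun x y ↦ ?_)
      (fun x y h ↦ hrel.eq_zero x h.1 y h.2.1) x y c).trans (by tauto)
    rw [F4Table.pairs_specialTable, F4Table.mem_pairs_unsignedTable]
    tauto
  · simp only [F4Table.isRoot_iff hF4, ← F4Table.toDual_neg]
    refine (F4Table.mem_table_iff (T := F4Table.negativeTable ε δ γ α)
      (f := fun x y ↦ N (F4Table.toDual p x) (F4Table.toDual p (-y))) hneg
      (Q := fun x y ↦ x ∈ F4Table.rootList ∧ y ∈ F4Table.rootList ∧ F4Table.Prec 0 x ∧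
        F4Table.Prec x y) (S := fun x y ↦ x + -y ∈ F4Table.rootList) (fun x y ↦ ?_)
      (fun x y h ↦ hrel.eq_zero x h.1 (-y) (F4Table.neg_mem_rootList y h.2.1).1) x y c).trans
      (by tauto)
    rw [F4Table.pairs_negativeTable, F4Table.mem_pairs_unsignedNegativeTable]
    tauto
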